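/- Let $\mathfrak H$ and $\mathfrak H_n$, $n\in\mathbb N$, be complex Hilbert spaces, let $J_n:\mathfrak H\to\mathfrak H_n$ be bounded linear operators with adjoints $J_n^*$, and let $A$ in $\mathfrak H$ and $A_n$ in $\mathfrak H_n$ be (possibly unbounded) self-adjoint operators. Write $R_B(z)=(B-z)^{-1}$ for the resolvent of $B$, $\Sigma:=\overline{\sigma(A)\cup\bigcup_n\sigma(A_n)}\subseteq\mathbb R$ and $\Gamma:=\mathbb C\setminus\Sigma$; for a bounded continuous $f:\Sigma\to\mathbb C$ the operators $f(A)$ and $f(A_n)$ are defined by the spectral theorem. We say that $A_n$ converges to $A$ in the generalized norm resolvent sense if $\|J_n\|\le C$ for all $n$ with some $C>0$, $\|J_n^*J_n-\mathbb I\|\to0$, $\|J_nJ_n^*-\mathbb I\|\to0$, and $$\lim_{n\to\infty}\|J_n^*R_{A_n}(z)J_n-R_A(z)\|=0\quad\text{for one }z\in\Gamma .$$ We say that $A_n$ converges to $A$ in the generalized strong resolvent sense if $\|J_n\|\le C$ for all $n$ with some $C>0$, $\|J_n^*J_n\psi-\psi\|\to0$ for all $\psi\in\mathfrak H$, and for one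 $z\in\Gamma$ $$\lim_{n\to\infty}\|J_n^*R_{A_n}(z)J_n\psi-R_A(z)\psi\|=0\quad\text{for all }\psi\in\mathfrak H,$$ where, in case this $z$ is real, it is required in addition that $\lim_{n\to\infty}\|R_{A_n}(z)J_n\psi-J_nR_A(z)\psi\|=0$ for all $\psi\in\mathfrak H$. **Theorem.** (i) Suppose that $A_n$ converges to $A$ in the generalized norm resolvent sense. Then $J_n$ has a bounded inverse for all sufficiently large $n$, and $$\lim_{n\to\infty}J_n^*f(A_n)J_n=\lim_{n\to\infty}J_n^{-1}f(A_n)J_n=f(A)$$ in operator norm for every bounded continuous function $f:\Sigma\to\mathbb C$ whose limits at $-\infty$ and at $+\infty$ exist and are equal (at an end at which $\Sigma$ is bounded, there is no condition). (ii) Suppose that $A_n$ converges to $A$ in the generalized strong resolvent sense. Then $$\lim_{n\to\infty}J_n^*f(A_n)J_n\psi=f(A)\psi\quad\text{for all }\psi\in\mathfrak H$$ for every bounded continuous function $f:\Sigma\to\mathbb C$. -/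

import Mathlib

open Filter Topology MeasureTheory

noncomputable section

namespace ResolventConvergence

section SingleOperator

variable {H : Type*} [NormedAddCommGroup H] [InnerProductSpace ℂ H]

/-- The bounded operator `R` is a two-sided inverse of `A - z : D(A) → H`. -/
def IsResolventAt (A : H →ₗ.[ℂ] H) (z : ℂ) (R : H →L[ℂ] H) : Prop :=
  (∀ ψ : H, ∃ h : R ψ ∈ A.domain, A ⟨R ψ, h⟩ - z • R ψ = ψ) ∧
    ∀ ψ : A.domain, R (A ψ - z • (ψ : H)) = ψ

/-- The resolvent set `ρ(A)` of an unbounded operator. -/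
def opResolventSet (A : H →ₗ.[ℂ] H) : Set ℂ :=
  {z | ∃ R : H →L[ℂ] H, IsResolventAt A z R}

/-- The spectrum `σ(A)` of an unbounded operator. -/
def opSpectrum (A : H →ₗ.[ℂ] H) : Set ℂ :=
  (opResolventSet A)ᶜ

open Classical in
/-- The resolvent `R_A(z) = (A - z)⁻¹` for `z ∈ ρ(A)` (and `0` for `z ∈ σ(A)`). -/
def opResolvent (A : H →ₗ.[ℂ] H) (z : ℂ) : H →L[ℂ] H :=
  if h : ∃ R : H →L[ℂ] H, IsResolventAt A z R then h.choose else 0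

/-- The finite Borel measure `μ` on `ℝ` has Borel transform `⟪ψ, R_A(z) ψ⟫`, that is,
`μ` is the spectral measure of the self-adjoint operator `A` with respect to `ψ`. -/
def IsSpectralMeasure (A : H →ₗ.[ℂ] H) (ψ : H) (μ : Measure ℝ) : Prop :=
  IsFiniteMeasure μ ∧
    ∀ z : ℂ, z.im ≠ 0 → inner ℂ ψ (opResolvent A z ψ) = ∫ t : ℝ, ((t : ℂ) - z)⁻¹ ∂μ

open Classical in
/-- The spectral measure `μ_ψ` of `A` with respect to `ψ`. By the spectral theorem it exists
and is unique if `A` is self-adjoint; it equals `Ω ↦ ⟪ψ, P_A(Ω) ψ⟫`. -/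
def spectralMeasure (A : H →ₗ.[ℂ] H) (ψ : H) : Measure ℝ :=
  if h : ∃ μ : Measure ℝ, IsSpectralMeasure A ψ μ then h.choose else 0

/-- `T = f(A) = ∫ f dP_A`: the quadratic form of the bounded operator `T` is
`⟪ψ, T ψ⟫ = ∫_{σ(A)} f dμ_ψ`. By polarization this determines `T`. -/
def IsFunctionOf (A : H →ₗ.[ℂ] H) (f : ℝ → ℂ) (T : H →L[ℂ] H) : Prop :=
  ∀ ψ : H, inner ℂ ψ (T ψ) =
    ∫ t in {t : ℝ | (t : ℂ) ∈ opSpectrum A}, f t ∂(spectralMeasure A ψ)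

open Classical in
/-- The operator `f(A)` for a self-adjoint operator `A` and a function `f` that is bounded and
measurable on `σ(A)`; only the values of `f` on `σ(A)` enter. -/
def functionOf (A : H →ₗ.[ℂ] H) (f : ℝ → ℂ) : H →L[ℂ] H :=
  if h : ∃ T : H →L[ℂ] H, IsFunctionOf A f T then h.choose else 0

end SingleOperator

section Convergence

variable {H : Type*} [NormedAddCommGroup H] [InnerProductSpace ℂ H]
  {K : ℕ → Type*} [∀ n, NormedAddCommGroup (K n)] [∀ n, InnerProductSpace ℂ (K n)]

/-- `Σ`, the closure of `σ(A) ∪ ⋃ₙ σ(Aₙ)`. -/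
def jointSpectrum (An : ∀ n, K n →ₗ.[ℂ] K n) (A : H →ₗ.[ℂ] H) : Set ℂ :=
  closure (opSpectrum A ∪ ⋃ n, opSpectrum (An n))

/-- `Σ ∩ ℝ` as a set of real numbers (this is all of `Σ` for self-adjoint operators). -/
def realJointSpectrum (An : ∀ n, K n →ₗ.[ℂ] K n) (A : H →ₗ.[ℂ] H) : Set ℝ :=
  {t | (t : ℂ) ∈ jointSpectrum An A}

variable [CompleteSpace H] [∀ n, CompleteSpace (K n)]

/-- Generalized norm resolvent convergence of `Aₙ` to `A` along `Jₙ : H → Hₙ`. -/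
def GenNormResolventConv (J : ∀ n, H →L[ℂ] K n) (An : ∀ n, K n →ₗ.[ℂ] K n)
    (A : H →ₗ.[ℂ] H) : Prop :=
  (∃ C : ℝ, 0 < C ∧ ∀ n, ‖J n‖ ≤ C) ∧
  Tendsto (fun n => ‖ContinuousLinearMap.adjoint (J n) ∘L J n - ContinuousLinearMap.id ℂ H‖) atTop (𝓝 0) ∧
  Tendsto (fun n => ‖J n ∘L ContinuousLinearMap.adjoint (J n) - ContinuousLinearMap.id ℂ (K n)‖) atTop (𝓝 0) ∧
  ∃ z ∈ (jointSpectrum An A)ᶜ,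
    Tendsto (fun n => ‖ContinuousLinearMap.adjoint (J n) ∘L opResolvent (An n) z ∘L J n - opResolvent A z‖) atTop (𝓝 0)

/-- Generalized strong resolvent convergence of `Aₙ` to `A` along `Jₙ : H → Hₙ`. At a real
point `z` the convergence of `Jₙ* R_{Aₙ}(z) Jₙ` alone is too weak a condition, so that there
`R_{Aₙ}(z) Jₙ ψ - Jₙ R_A(z) ψ → 0` is required too. -/
def GenStrongResolventConv (J : ∀ n, H →L[ℂ] K n) (An : ∀ n, K n →ₗ.[ℂ] K n)
    (A : H →ₗ.[ℂ] H) : Prop :=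
  (∃ C : ℝ, 0 < C ∧ ∀ n, ‖J n‖ ≤ C) ∧
  (∀ ψ : H, Tendsto (fun n => ‖ContinuousLinearMap.adjoint (J n) (J n ψ) - ψ‖) atTop (𝓝 0)) ∧
  ∃ z ∈ (jointSpectrum An A)ᶜ,
    (∀ ψ : H, Tendsto
      (fun n => ‖ContinuousLinearMap.adjoint (J n) (opResolvent (An n) z (J n ψ)) - opResolvent A z ψ‖) atTop (𝓝 0)) ∧
    (z.im = 0 → ∀ ψ : H, Tendsto
      (fun n => ‖opResolvent (An n) z (J n ψ) - J n (opResolvent A z ψ)‖) atTop (𝓝 0))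

/-- `f` is a bounded continuous function on `S`. -/
def BoundedContinuousOn (f : ℝ → ℂ) (S : Set ℝ) : Prop :=
  ContinuousOn f S ∧ ∃ M : ℝ, ∀ t ∈ S, ‖f t‖ ≤ M

/-- The limits of `f : S → ℂ` at `-∞` and at `∞` exist and are equal; a limit at an end at which
`S` is bounded is no condition. -/
def EqualLimitsAtInfty (f : ℝ → ℂ) (S : Set ℝ) : Prop :=
  ∃ c : ℂ, Tendsto f (atBot ⊓ 𝓟 S) (𝓝 c) ∧ Tendsto f (atTop ⊓ 𝓟 S) (𝓝 c)

end Convergence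

end ResolventConvergence

end

open Filter Topology MeasureTheory
open scoped ComplexConjugate BoundedContinuousFunction

namespace ResolventConvergence

section Resolvent

variable {H : Type*} [NormedAddCommGroup H] [InnerProductSpace ℂ H]
  {A : H →ₗ.[ℂ] H} {z w : ℂ} {R S : H →L[ℂ] H}

lemma IsResolventAt.unique (hR : IsResolventAt A z R) (hS : IsResolventAt A z S) : R = S := by
  ext φ
  obtain ⟨h, hφ⟩ := hR.1 φ
  have := hS.2 ⟨R φ, h⟩
  simpa only [hφ] using this.symm

lemma isResolventAt_opResolvent (h : z ∈ opResolventSet A) :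
    IsResolventAt A z (opResolvent A z) := by
  have h' : ∃ R : H →L[ℂ] H, IsResolventAt A z R := h
  rw [opResolvent, dif_pos h']
  exact h'.choose_spec

/-- The first resolvent identity. -/
lemma IsResolventAt.sub_eq (hR : IsResolventAt A z R) (hS : IsResolventAt A w S) :
    R - S = (z - w) • (R * S) := by
  ext φ
  obtain ⟨h, hφ⟩ := hS.1 φ
  have h1 := hR.2 ⟨S φ, h⟩
  rw [eq_add_of_sub_eq hφ] at h1
  have h2 : φ + w • S φ - z • S φ = φ - (z - w) • S φ := by rw [sub_smul]; abel
  simp only [h2, map_sub, map_smul] at h1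
  simp only [sub_apply, smul_apply, mul_apply_eq_comp]
  exact sub_eq_iff_eq_add'.mpr (sub_eq_iff_eq_add.mp h1)

lemma IsResolventAt.mem_opSpectrum_of_mem_spectrum (hR : IsResolventAt A z R)
    (hw : w ∈ spectrum ℂ R) (hw0 : w ≠ 0) : z + w⁻¹ ∈ opSpectrum A := by
  rintro ⟨S, hS⟩
  apply hw
  have h1 := hR.sub_eq hS
  have h2 := hS.sub_eq hR
  have e1 : z - (z + w⁻¹) = -w⁻¹ := by ring
  have e2 : (z + w⁻¹) - z = w⁻¹ := by ring
  rw [e1] at h1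
  rw [e2] at h2
  have h3 : R * S = w • S - w • R := by
    rw [← smul_sub, ← neg_sub R S, h1, neg_smul, neg_neg, smul_smul, mul_inv_cancel₀ hw0, one_smul]
  have h4 : S * R = w • S - w • R := by
    rw [← smul_sub, h2, smul_smul, mul_inv_cancel₀ hw0, one_smul]
  rw [spectrum.mem_resolventSet_iff, Algebra.algebraMap_eq_smul_one]
  refine ⟨⟨w • 1 - R, (w ^ 2)⁻¹ • (w • 1 + S), ?_, ?_⟩, rfl⟩
  · have : (w • (1 : H →L[ℂ] H) - R) * (w • 1 + S) = (w ^ 2) • 1 := by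
      rw [sub_mul, mul_add, mul_add, h3]
      simp only [smul_mul_assoc, one_mul, mul_smul_comm, mul_one, smul_smul, pow_two]
      abel
    rw [mul_smul_comm, this, smul_smul, inv_mul_cancel₀ (pow_ne_zero 2 hw0), one_smul]
  · have : (w • 1 + S) * (w • (1 : H →L[ℂ] H) - R) = (w ^ 2) • 1 := by
      rw [add_mul, mul_sub, mul_sub, h4]
      simp only [smul_mul_assoc, one_mul, mul_smul_comm, mul_one, smul_smul, pow_two]
      abel
    rw [smul_mul_assoc, this, smul_smul, inv_mul_cancel₀ (pow_ne_zero 2 hw0), one_smul]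

variable [CompleteSpace H]

lemma exists_mem_domain_of_inner_eq (hA : IsSelfAdjoint A) {x y : H}
    (h : ∀ d : A.domain, inner ℂ y (d : H) = inner ℂ x (A d)) :
    ∃ hx : x ∈ A.domain, A ⟨x, hx⟩ = y := by
  have hd := hA.dense_domain
  have hx : x ∈ A.adjoint.domain := LinearPMap.mem_adjoint_domain_of_exists _ ⟨y, h⟩
  have hxy : A.adjoint ⟨x, hx⟩ = y := LinearPMap.adjoint_apply_eq hd ⟨x, hx⟩ h
  have hA' : A.adjoint = A := LinearPMap.isSelfAdjoint_def.mp hA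
  revert hx
  rw [hA']
  exact fun hx h => ⟨hx, h⟩

lemma inner_apply_comm (hA : IsSelfAdjoint A) (x y : A.domain) :
    inner ℂ (A x) (y : H) = inner ℂ (x : H) (A y) := by
  have := LinearPMap.adjoint_isFormalAdjoint hA.dense_domain
  rw [LinearPMap.isSelfAdjoint_def.mp hA] at this
  exact this x y

lemma im_inner_apply_self (hA : IsSelfAdjoint A) (x : A.domain) :
    (inner ℂ (x : H) (A x)).im = 0 := by
  rw [← Complex.conj_eq_iff_im, inner_conj_symm, inner_apply_comm hA]

lemma im_inner_apply_sub_smul (hA : IsSelfAdjoint A) (z : ℂ) (x : A.domain) :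
    (inner ℂ (x : H) (A x - z • (x : H))).im = -(z.im * ‖(x : H)‖ ^ 2) := by
  rw [inner_sub_right, inner_smul_right, Complex.sub_im, im_inner_apply_self hA,
    inner_self_eq_norm_sq_to_K]
  simp [← Complex.ofReal_pow]

lemma abs_im_mul_norm_le (hA : IsSelfAdjoint A) (z : ℂ) (x : A.domain) :
    |z.im| * ‖(x : H)‖ ≤ ‖A x - z • (x : H)‖ := by
  rcases (norm_nonneg (x : H)).eq_or_lt with h | h
  · rw [← h]; simp
  · have h1 := (Complex.abs_im_le_norm _).trans
      (norm_inner_le_norm (𝕜 := ℂ) (x : H) (A x - z • (x : H)))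
    rw [im_inner_apply_sub_smul hA, abs_neg, abs_mul, abs_of_nonneg (sq_nonneg ‖(x : H)‖)] at h1
    refine le_of_mul_le_mul_left ?_ h
    calc _ = |z.im| * ‖(x : H)‖ ^ 2 := by ring
      _ ≤ _ := h1

lemma IsResolventAt.adjoint (hA : IsSelfAdjoint A) (hR : IsResolventAt A z R) :
    IsResolventAt A (conj z) (ContinuousLinearMap.adjoint R) := by
  constructor
  · intro ψ
    have : ∃ hx : ContinuousLinearMap.adjoint R ψ ∈ A.domain,
        A ⟨ContinuousLinearMap.adjoint R ψ, hx⟩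
          = ψ + conj z • ContinuousLinearMap.adjoint R ψ := by
      apply exists_mem_domain_of_inner_eq hA
      intro d
      have h1 := hR.2 d
      have h2 : inner ℂ (ContinuousLinearMap.adjoint R ψ) (A d - z • (d : H))
          = inner ℂ ψ (d : H) := by
        rw [ContinuousLinearMap.adjoint_inner_left, h1]
      rw [inner_sub_right, inner_smul_right, sub_eq_iff_eq_add] at h2
      rw [h2, inner_add_left, inner_smul_left]
      simp
    obtain ⟨hx, h⟩ := this
    exact ⟨hx, by rw [h]; abel⟩
  · intro ψ
    refine ext_inner_right ℂ fun χ => ?_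
    obtain ⟨hχ, h⟩ := hR.1 χ
    rw [ContinuousLinearMap.adjoint_inner_left, inner_sub_left, inner_smul_left,
      Complex.conj_conj, inner_apply_comm hA ψ ⟨R χ, hχ⟩, ← inner_smul_right, ← inner_sub_right, h]

lemma IsResolventAt.isStarNormal (hA : IsSelfAdjoint A) (hR : IsResolventAt A z R) :
    IsStarNormal R := by
  have hR' := hR.adjoint hA
  constructor
  change ContinuousLinearMap.adjoint R * R = R * ContinuousLinearMap.adjoint R
  by_cases hz : z = conj z
  · have : R = ContinuousLinearMap.adjoint R := hR.unique (by rwa [← hz] at hR')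
    rw [← this]
  · have h1 := hR.sub_eq hR'
    have h2 := hR'.sub_eq hR
    have h3 : (z - conj z) • (ContinuousLinearMap.adjoint R * R)
        = (z - conj z) • (R * ContinuousLinearMap.adjoint R) := by
      rw [← h1, ← neg_sub (ContinuousLinearMap.adjoint R) R, h2, ← neg_smul, neg_sub]
    exact smul_right_injective _ (sub_ne_zero.mpr hz) h3

lemma IsResolventAt.im_inner (hA : IsSelfAdjoint A) (hR : IsResolventAt A z R) (ψ : H) :
    (inner ℂ ψ (R ψ)).im = z.im * ‖R ψ‖ ^ 2 := by
  obtain ⟨h, hψ⟩ := hR.1 ψ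
  have := im_inner_apply_sub_smul hA z ⟨R ψ, h⟩
  rw [hψ] at this
  rw [← inner_conj_symm, Complex.conj_im, this]
  simp

lemma IsResolventAt.denseRange (hA : IsSelfAdjoint A) (hR : IsResolventAt A z R) :
    DenseRange R := by
  refine hA.dense_domain.mono fun x hx => ?_
  exact ⟨_, hR.2 ⟨x, hx⟩⟩

lemma mem_opResolventSet_of_im_ne_zero (hA : IsSelfAdjoint A) (hz : z.im ≠ 0) :
    z ∈ opResolventSet A := by
  let T : A.domain →ₗ[ℂ] H := A.toFun - z • A.domain.subtype
  have hT : ∀ x : A.domain, T x = A x - z • (x : H) := fun x => rfl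
  have hb : ∀ x : A.domain, ‖(x : H)‖ ≤ |z.im|⁻¹ * ‖T x‖ := fun x => by
    rw [inv_mul_eq_div, le_div_iff₀' (abs_pos.mpr hz)]
    exact abs_im_mul_norm_le hA z x
  have hinj : Function.Injective T := by
    rw [injective_iff_map_eq_zero]
    intro x hx
    have := hb x
    rw [hx, norm_zero, mul_zero] at this
    exact Subtype.ext (norm_le_zero_iff.mp this)
  have hclosed : IsClosed (LinearMap.range T : Set H) := by
    refine IsSeqClosed.isClosed fun u y hu huy => ?_
    choose x hx using hu
    have hc : CauchySeq (fun n => (x n : H)) := by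
      have hcu := huy.cauchySeq
      rw [Metric.cauchySeq_iff'] at hcu ⊢
      intro ε hε
      obtain ⟨N, hN⟩ := hcu (ε * |z.im|) (mul_pos hε (abs_pos.mpr hz))
      refine ⟨N, fun n hn => ?_⟩
      have h1 := hb (x n - x N)
      have h2 := hN n hn
      rw [map_sub, hx, hx, ← dist_eq_norm] at h1
      rw [dist_eq_norm, ← Submodule.coe_sub]
      refine h1.trans_lt ?_
      rwa [inv_mul_eq_div, div_lt_iff₀ (abs_pos.mpr hz)]
    obtain ⟨x₀, hx₀⟩ := cauchySeq_tendsto_of_complete hc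
    have hAx : Tendsto (fun n => A (x n)) atTop (𝓝 (y + z • x₀)) := by
      have := huy.add (hx₀.const_smul z)
      refine this.congr fun n => ?_
      rw [← hx n, hT]; abel
    obtain ⟨hm, he⟩ := exists_mem_domain_of_inner_eq hA (x := x₀) (y := y + z • x₀) fun d => by
      refine tendsto_nhds_unique (hAx.inner tendsto_const_nhds)
        ((hx₀.inner (tendsto_const_nhds (x := A d))).congr fun n => ?_)
      exact (inner_apply_comm hA (x n) d).symm
    exact ⟨⟨x₀, hm⟩, by rw [hT, he]; abel⟩
  have hsurj : Function.Surjective T := by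
    rw [← LinearMap.range_eq_top]
    have : CompleteSpace (LinearMap.range T) := hclosed.completeSpace_coe
    rw [← Submodule.orthogonal_eq_bot_iff, Submodule.eq_bot_iff]
    intro v hv
    obtain ⟨hm, he⟩ := exists_mem_domain_of_inner_eq hA (x := v) (y := conj z • v) fun d => by
      have h0 := (Submodule.mem_orthogonal' _ _).mp hv (T d) ⟨d, rfl⟩
      rw [hT, inner_sub_right, inner_smul_right, sub_eq_zero] at h0
      rw [inner_smul_left, Complex.conj_conj, h0]
    have h1 := abs_im_mul_norm_le hA (conj z) ⟨v, hm⟩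
    rw [he, sub_self, norm_zero, Complex.conj_im, abs_neg] at h1
    exact norm_le_zero_iff.mp (nonpos_of_mul_nonpos_right h1 (abs_pos.mpr hz))
  let e : A.domain ≃ₗ[ℂ] H := LinearEquiv.ofBijective T ⟨hinj, hsurj⟩
  have he : ∀ x, T (e.symm x) = x := fun x => e.apply_symm_apply x
  refine ⟨(A.domain.subtype ∘ₗ e.symm.toLinearMap).mkContinuous |z.im|⁻¹ fun ψ => ?_, ?_, ?_⟩
  · have := hb (e.symm ψ)
    rwa [he] at this
  · exact fun ψ => ⟨(e.symm ψ).2, he ψ⟩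
  · intro ψ
    exact congrArg Subtype.val (e.symm_apply_apply ψ)

lemma im_eq_zero_of_mem_opSpectrum (hA : IsSelfAdjoint A) (hz : z ∈ opSpectrum A) :
    z.im = 0 := by
  by_contra h
  exact hz (mem_opResolventSet_of_im_ne_zero hA h)

end Resolvent

section BorelTransform

variable {z w : ℂ}

lemma ofReal_sub_ne_zero (hz : z.im ≠ 0) (t : ℝ) : (t : ℂ) - z ≠ 0 := fun h => hz <| by
  rw [← sub_eq_zero.mp h, Complex.ofReal_im]

lemma norm_inv_ofReal_sub_le (hz : z.im ≠ 0) (t : ℝ) : ‖((t : ℂ) - z)⁻¹‖ ≤ |z.im|⁻¹ := by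
  rw [norm_inv]
  refine inv_anti₀ (abs_pos.mpr hz) ?_
  have := Complex.abs_im_le_norm ((t : ℂ) - z)
  simpa using this

/-- The function `t ↦ (t - z)⁻¹` on the real line, for nonreal `z`. -/
noncomputable def cauchyKernel (z : ℂ) (hz : z.im ≠ 0) : ℝ →ᵇ ℂ :=
  BoundedContinuousFunction.ofNormedAddCommGroup (fun t : ℝ => ((t : ℂ) - z)⁻¹)
    ((Complex.continuous_ofReal.sub continuous_const).inv₀ (ofReal_sub_ne_zero hz)) |z.im|⁻¹
    (norm_inv_ofReal_sub_le hz)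

@[simp]
lemma cauchyKernel_apply (hz : z.im ≠ 0) (t : ℝ) : cauchyKernel z hz t = ((t : ℂ) - z)⁻¹ := rfl

lemma cauchyKernel_mul (hz : z.im ≠ 0) (hw : w.im ≠ 0) :
    (z - w) • (cauchyKernel z hz * cauchyKernel w hw) = cauchyKernel z hz - cauchyKernel w hw := by
  ext t
  have h1 := ofReal_sub_ne_zero hz t
  have h2 := ofReal_sub_ne_zero hw t
  simp only [BoundedContinuousFunction.coe_smul, BoundedContinuousFunction.coe_mul, Pi.mul_apply,
    cauchyKernel_apply, smul_eq_mul, BoundedContinuousFunction.coe_sub, Pi.sub_apply]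
  field_simp
  ring

lemma star_cauchyKernel (hz : z.im ≠ 0) :
    star (cauchyKernel z hz) = cauchyKernel (conj z) (by simpa using hz) := by
  ext t
  simp

/-- The closed linear span of the constants and the functions `t ↦ (t - z)⁻¹`. -/
noncomputable def cauchySpan : Submodule ℂ (ℝ →ᵇ ℂ) :=
  (Submodule.span ℂ ({1} ∪ {g | ∃ z, ∃ hz : z.im ≠ 0, g = cauchyKernel z hz})).topologicalClosure

lemma cauchyKernel_mem_cauchySpan (hz : z.im ≠ 0) : cauchyKernel z hz ∈ cauchySpan :=
  Submodule.le_topologicalClosure _ (Submodule.subset_span (Or.inr ⟨z, hz, rfl⟩))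

lemma one_mem_cauchySpan : 1 ∈ cauchySpan :=
  Submodule.le_topologicalClosure _ (Submodule.subset_span (Or.inl rfl))

lemma cauchyKernel_mul_mem_cauchySpan_of_ne (hz : z.im ≠ 0) (hw : w.im ≠ 0) (hzw : z ≠ w) :
    cauchyKernel z hz * cauchyKernel w hw ∈ cauchySpan := by
  have h : cauchyKernel z hz * cauchyKernel w hw
      = (z - w)⁻¹ • (cauchyKernel z hz - cauchyKernel w hw) := by
    rw [← cauchyKernel_mul, smul_smul, inv_mul_cancel₀ (sub_ne_zero.mpr hzw), one_smul]
  rw [h]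
  exact cauchySpan.smul_mem _
    (cauchySpan.sub_mem (cauchyKernel_mem_cauchySpan hz) (cauchyKernel_mem_cauchySpan hw))

lemma tendsto_cauchyKernel (hz : z.im ≠ 0) : ∃ (u : ℕ → ℂ) (hu : ∀ n, (u n).im ≠ 0),
    (∀ n, u n ≠ z) ∧ Tendsto (fun n => cauchyKernel (u n) (hu n)) atTop (𝓝 (cauchyKernel z hz)) := by
  let a : ℕ → ℝ := fun n => 1 / ((n : ℝ) + 1)
  have ha : ∀ n, a n ≠ 0 := fun n => by positivity
  have hat : Tendsto a atTop (𝓝 0) := tendsto_one_div_add_atTop_nhds_zero_nat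
  have hu : ∀ n, (z + a n).im ≠ 0 := fun n => by simpa using hz
  refine ⟨fun n => z + a n, hu, fun n => by simpa using ha n, ?_⟩
  rw [tendsto_iff_norm_sub_tendsto_zero]
  have hb : ∀ n, ‖cauchyKernel (z + a n) (hu n) - cauchyKernel z hz‖
      ≤ |a n| * (|z.im|⁻¹ * |z.im|⁻¹) := fun n => by
    rw [← cauchyKernel_mul, norm_smul]
    have e : ‖z + (a n : ℂ) - z‖ = |a n| := by simp
    rw [e]
    gcongr
    refine (norm_mul_le _ _).trans ?_
    gcongr
    · refine (BoundedContinuousFunction.norm_ofNormedAddCommGroup_le _ (by positivity) _).trans ?_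
      simp
    · exact BoundedContinuousFunction.norm_ofNormedAddCommGroup_le _ (by positivity) _
  refine squeeze_zero (fun n => norm_nonneg _) hb ?_
  simpa using hat.abs.mul_const (|z.im|⁻¹ * |z.im|⁻¹)

lemma cauchyKernel_mul_mem_cauchySpan (hz : z.im ≠ 0) {g : ℝ →ᵇ ℂ} (hg : g ∈ cauchySpan) :
    cauchyKernel z hz * g ∈ cauchySpan := by
  have hcl : IsClosed (cauchySpan : Set (ℝ →ᵇ ℂ)) := Submodule.isClosed_topologicalClosure _
  have key : Submodule.span ℂ ({1} ∪ {g | ∃ z, ∃ hz : z.im ≠ 0, g = cauchyKernel z hz})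
      ≤ cauchySpan.comap (LinearMap.mulLeft ℂ (cauchyKernel z hz)) := by
    rw [Submodule.span_le]
    rintro _ (rfl | ⟨w, hw, rfl⟩)
    · simpa using cauchyKernel_mem_cauchySpan hz
    · rw [SetLike.mem_coe, Submodule.mem_comap, LinearMap.mulLeft_apply]
      obtain ⟨u, hu, huz, hlim⟩ := tendsto_cauchyKernel hw
      by_cases hzw : z = w
      · subst hzw
        refine hcl.mem_of_tendsto (hlim.const_mul (cauchyKernel z hz)) (Eventually.of_forall ?_)
        exact fun n => cauchyKernel_mul_mem_cauchySpan_of_ne hz (hu n) (huz n).symm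
      · exact cauchyKernel_mul_mem_cauchySpan_of_ne hz hw hzw
  have hcl' : IsClosed ((cauchySpan.comap (LinearMap.mulLeft ℂ (cauchyKernel z hz)) :
      Submodule ℂ (ℝ →ᵇ ℂ)) : Set (ℝ →ᵇ ℂ)) :=
    hcl.preimage (continuous_const_mul (cauchyKernel z hz))
  exact Submodule.topologicalClosure_minimal _ key hcl' hg

/-- The star subalgebra generated by the functions `t ↦ (t - z)⁻¹`. -/
noncomputable def cauchyAlgebra : StarSubalgebra ℂ (ℝ →ᵇ ℂ) :=
  StarAlgebra.adjoin ℂ {g | ∃ z, ∃ hz : z.im ≠ 0, g = cauchyKernel z hz}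

lemma mem_cauchySpan_of_mem_cauchyAlgebra {g : ℝ →ᵇ ℂ} (hg : g ∈ cauchyAlgebra) :
    g ∈ cauchySpan := by
  have hstar : star {g | ∃ z, ∃ hz : z.im ≠ 0, g = cauchyKernel z hz}
      ⊆ {g | ∃ z, ∃ hz : z.im ≠ 0, g = cauchyKernel z hz} := by
    rintro g ⟨z, hz, h⟩
    exact ⟨conj z, by simpa using hz, by rw [← star_cauchyKernel hz, ← h, star_star]⟩
  have h1 : g ∈ Algebra.adjoin ℂ {g | ∃ z, ∃ hz : z.im ≠ 0, g = cauchyKernel z hz} := by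
    have h2 : g ∈ (StarAlgebra.adjoin ℂ
      {g | ∃ z, ∃ hz : z.im ≠ 0, g = cauchyKernel z hz}).toSubalgebra := hg
    rwa [StarAlgebra.adjoin_toSubalgebra, Set.union_eq_self_of_subset_right hstar] at h2
  rw [← Subalgebra.mem_toSubmodule, Algebra.adjoin_eq_span] at h1
  refine (Submodule.span_le.mpr fun m hm => ?_) h1
  induction hm using Submonoid.closure_induction_left with
  | one => exact one_mem_cauchySpan
  | mul_left x hx y hy ih =>
    obtain ⟨z, hz, rfl⟩ := hx
    exact cauchyKernel_mul_mem_cauchySpan hz ih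

lemma separatesPoints_cauchyAlgebra :
    (cauchyAlgebra.map (BoundedContinuousFunction.toContinuousMapStarₐ ℂ)).SeparatesPoints := by
  intro s t hst
  have hI : Complex.I.im ≠ 0 := by simp
  refine ⟨_, ⟨_, ⟨cauchyKernel Complex.I hI, StarAlgebra.subset_adjoin ℂ _ ⟨_, hI, rfl⟩, rfl⟩,
    rfl⟩, ?_⟩
  intro h
  have h' : ((s : ℂ) - Complex.I)⁻¹ = ((t : ℂ) - Complex.I)⁻¹ := h
  rw [inv_inj, sub_left_inj] at h'
  exact hst (Complex.ofReal_injective h')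

lemma tendsto_integral_cauchyKernel (μ : Measure ℝ) [IsFiniteMeasure μ] :
    Tendsto (fun n : ℕ => -(((n : ℝ) + 1 : ℝ) * Complex.I) *
      ∫ t : ℝ, ((t : ℂ) - ((n : ℝ) + 1 : ℝ) * Complex.I)⁻¹ ∂μ) atTop (𝓝 (μ.real Set.univ : ℂ)) := by
  simp_rw [← integral_const_mul]
  have h1 : (μ.real Set.univ : ℂ) = ∫ _ : ℝ, (1 : ℂ) ∂μ := by simp
  rw [h1]
  have him : ∀ n : ℕ, ((((n : ℝ) + 1 : ℝ) : ℂ) * Complex.I).im = (n : ℝ) + 1 := fun n => by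
    simp
  have hpos : ∀ n : ℕ, (0 : ℝ) < (n : ℝ) + 1 := fun n => by positivity
  have hne : ∀ n : ℕ, ((((n : ℝ) + 1 : ℝ) : ℂ) * Complex.I).im ≠ 0 := fun n => by
    rw [him]
    exact (hpos n).ne'
  have hle : ∀ (n : ℕ) (t : ℝ), ‖((t : ℂ) - ((n : ℝ) + 1 : ℝ) * Complex.I)⁻¹‖
      ≤ ((n : ℝ) + 1)⁻¹ := fun n t => by
    have := norm_inv_ofReal_sub_le (hne n) t
    rwa [him, abs_of_pos (hpos n)] at this
  refine tendsto_integral_of_dominated_convergence (fun _ => 1) (fun n => ?_)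
    (integrable_const _) (fun n => Eventually.of_forall fun t => ?_)
    (Eventually.of_forall fun t => ?_)
  · exact (continuous_const.mul (cauchyKernel _ (hne n)).continuous).aestronglyMeasurable
  · rw [norm_mul, norm_neg, norm_mul, Complex.norm_I, mul_one, Complex.norm_real, Real.norm_eq_abs,
      abs_of_pos (hpos n)]
    exact (mul_le_mul_of_nonneg_left (hle n t) (hpos n).le).trans_eq
      (mul_inv_cancel₀ (hpos n).ne')
  · rw [tendsto_iff_norm_sub_tendsto_zero]
    refine squeeze_zero (fun n => norm_nonneg _) (g := fun n : ℕ => |t| * ((n : ℝ) + 1)⁻¹)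
      (fun n => ?_) ?_
    · have e : -(((n : ℝ) + 1 : ℝ) * Complex.I) * ((t : ℂ) - ((n : ℝ) + 1 : ℝ) * Complex.I)⁻¹ - 1
          = -((t : ℂ) * ((t : ℂ) - ((n : ℝ) + 1 : ℝ) * Complex.I)⁻¹) := by
        have := ofReal_sub_ne_zero (hne n) t
        field_simp
        ring
      rw [e, norm_neg, norm_mul, Complex.norm_real, Real.norm_eq_abs]
      exact mul_le_mul_of_nonneg_left (hle n t) (abs_nonneg t)
    · simpa using (tendsto_one_div_add_atTop_nhds_zero_nat (𝕜 := ℝ)).const_mul |t|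

theorem measure_ext_of_borelTransform {μ ν : Measure ℝ} [IsFiniteMeasure μ] [IsFiniteMeasure ν]
    (h : ∀ z : ℂ, z.im ≠ 0 → ∫ t : ℝ, ((t : ℂ) - z)⁻¹ ∂μ = ∫ t : ℝ, ((t : ℂ) - z)⁻¹ ∂ν) :
    μ = ν := by
  have hmass : (μ.real Set.univ : ℂ) = ν.real Set.univ := by
    refine tendsto_nhds_unique (tendsto_integral_cauchyKernel μ)
      ((tendsto_integral_cauchyKernel ν).congr fun n => ?_)
    rw [h]
    have : (n : ℝ) + 1 ≠ 0 := by positivity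
    simpa using this
  refine ext_of_forall_mem_subalgebra_integral_eq_of_pseudoEMetric_complete_countable
    separatesPoints_cauchyAlgebra fun g hg => ?_
  replace hg := mem_cauchySpan_of_mem_cauchyAlgebra hg
  have hL : ∀ ρ : Measure ℝ, IsFiniteMeasure ρ →
      Continuous fun g : ℝ →ᵇ ℂ => ∫ t, g t ∂ρ := fun ρ _ => by
    have : (fun g : ℝ →ᵇ ℂ => ∫ t, g t ∂ρ)
        = fun g => ∫ t, BoundedContinuousFunction.toLp 1 ρ ℂ g t ∂ρ := by
      ext g
      exact (integral_congr_ae (BoundedContinuousFunction.coeFn_toLp 1 ρ ℂ g)).symm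
    rw [this]
    exact continuous_integral.comp (BoundedContinuousFunction.toLp 1 ρ ℂ).continuous
  let V : Submodule ℂ (ℝ →ᵇ ℂ) :=
    { carrier := {g | ∫ t, g t ∂μ = ∫ t, g t ∂ν}
      zero_mem' := by simp
      add_mem' := fun {f g} hf hg => by
        simp only [Set.mem_ofPred_eq, BoundedContinuousFunction.coe_add, Pi.add_apply] at hf hg ⊢
        rw [integral_add (f.integrable μ) (g.integrable μ),
          integral_add (f.integrable ν) (g.integrable ν), hf, hg]
      smul_mem' := fun c g hg => by
        simp only [Set.mem_ofPred_eq, BoundedContinuousFunction.coe_smul] at hg ⊢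
        rw [integral_smul, integral_smul, hg] }
  refine Submodule.topologicalClosure_minimal (t := V) _ (Submodule.span_le.mpr ?_)
    (isClosed_eq (hL μ inferInstance) (hL ν inferInstance)) hg
  rintro _ (rfl | ⟨z, hz, rfl⟩)
  · change ∫ t, (1 : ℂ) ∂μ = ∫ t, (1 : ℂ) ∂ν
    simpa using hmass
  · exact h z hz

end BorelTransform

section NormalOperator

variable {H : Type*} [NormedAddCommGroup H] [InnerProductSpace ℂ H]

lemma tendsto_zero_of_denseRange {E K : Type*} [NormedAddCommGroup K] [NormedSpace ℂ K]
    {T : ℕ → H →L[ℂ] K} {C : ℝ} (hC : ∀ n, ‖T n‖ ≤ C) {R : E → H} (hR : DenseRange R)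
    (h : ∀ φ, Tendsto (fun n => T n (R φ)) atTop (𝓝 0)) (ψ : H) :
    Tendsto (fun n => T n ψ) atTop (𝓝 0) := by
  have hC0 : 0 ≤ C := (norm_nonneg _).trans (hC 0)
  rw [Metric.tendsto_atTop]
  intro ε hε
  obtain ⟨φ, hφ⟩ := hR.exists_dist_lt ψ (ε := ε / (2 * (C + 1))) (by positivity)
  obtain ⟨N, hN⟩ := Metric.tendsto_atTop.mp (h φ) (ε / 2) (by positivity)
  refine ⟨N, fun n hn => ?_⟩
  have h1 := hN n hn
  rw [dist_zero_right] at h1 ⊢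
  have h2 : ‖T n (ψ - R φ)‖ ≤ ε / 2 := by
    refine ((T n).le_of_opNorm_le (hC n) _).trans ?_
    rw [← dist_eq_norm]
    calc C * dist ψ (R φ) ≤ (C + 1) * (ε / (2 * (C + 1))) :=
          mul_le_mul (by linarith) hφ.le dist_nonneg (by positivity)
      _ = ε / 2 := by field_simp
  calc ‖T n ψ‖ = ‖T n (ψ - R φ) + T n (R φ)‖ := by rw [← map_add, sub_add_cancel]
    _ ≤ _ := norm_add_le _ _
    _ < ε := by linarith

variable [CompleteSpace H] {R : H →L[ℂ] H}

/-- The complexification of a real-valued continuous function. -/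
def complexify {X : Type*} [TopologicalSpace X] (g : C(X, ℝ)) : C(X, ℂ) :=
  ⟨fun x => (g x : ℂ), Complex.continuous_ofReal.comp g.continuous⟩

lemma inner_cfcHom_complexify (hR : IsStarNormal R) (g : C(spectrum ℂ R, ℝ)) (ψ : H) :
    (((inner ℂ ψ (cfcHom hR (complexify g) ψ)).re : ℝ) : ℂ)
      = inner ℂ ψ (cfcHom hR (complexify g) ψ) := by
  have hs : star (complexify g) = complexify g := by ext x; simp [complexify]
  have ha : ContinuousLinearMap.adjoint (cfcHom hR (complexify g)) = cfcHom hR (complexify g) := by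
    rw [← ContinuousLinearMap.star_eq_adjoint, ← map_star, hs]
  rw [← Complex.conj_eq_iff_re, inner_conj_symm, ← ContinuousLinearMap.adjoint_inner_right, ha]

lemma re_inner_cfcHom_nonneg (hR : IsStarNormal R) {g : C(spectrum ℂ R, ℝ)} (hg : 0 ≤ g) (ψ : H) :
    0 ≤ (inner ℂ ψ (cfcHom hR (complexify g) ψ)).re := by
  let s : C(spectrum ℂ R, ℝ) := ⟨fun x => √(g x), by fun_prop⟩
  have h1 : complexify g = star (complexify s) * complexify s := by
    ext x
    have := Real.mul_self_sqrt (hg x)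
    simp only [complexify, ContinuousMap.coe_mk, ContinuousMap.mul_apply, ContinuousMap.star_apply,
      s, RCLike.star_def, Complex.conj_ofReal]
    exact_mod_cast this.symm
  rw [h1, map_mul, map_star, ContinuousLinearMap.star_eq_adjoint, mul_apply_eq_comp,
    ContinuousLinearMap.adjoint_inner_right]
  exact inner_self_nonneg (𝕜 := ℂ)

/-- The positive functional `g ↦ ⟪ψ, g(R) ψ⟫` for a normal operator `R`. -/
noncomputable def quadraticFunctional (hR : IsStarNormal R) (ψ : H) :
    CompactlySupportedContinuousMap (spectrum ℂ R) ℝ →ₚ[ℝ] ℝ where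
  toFun g := (inner ℂ ψ (cfcHom hR (complexify g.toContinuousMap) ψ)).re
  map_add' g h := by
    have : complexify (g + h).toContinuousMap
        = complexify g.toContinuousMap + complexify h.toContinuousMap := by
      ext x; simp [complexify]
    rw [this, map_add, add_apply, inner_add_right, Complex.add_re]
  map_smul' c g := by
    have : complexify (c • g).toContinuousMap
        = (c : ℂ) • complexify g.toContinuousMap := by
      ext x; simp [complexify]
    rw [this, map_smul, smul_apply, inner_smul_right, Complex.re_ofReal_mul]
    rfl
  monotone' g h hgh := by
    have h0 : 0 ≤ h.toContinuousMap - g.toContinuousMap := sub_nonneg.mpr hgh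
    have : complexify h.toContinuousMap = complexify g.toContinuousMap
        + complexify (h.toContinuousMap - g.toContinuousMap) := by
      ext x; simp [complexify]
    change _ ≤ (inner ℂ ψ (cfcHom hR (complexify h.toContinuousMap) ψ)).re
    rw [this, map_add, add_apply, inner_add_right, Complex.add_re]
    exact le_add_of_nonneg_right (re_inner_cfcHom_nonneg hR h0 ψ)

/-- The spectral measure of a bounded normal operator at a vector. -/
lemma exists_measure_inner_cfc (hR : IsStarNormal R) (ψ : H) :
    ∃ ν : Measure ℂ, IsFiniteMeasure ν ∧ (∀ᵐ w ∂ν, w ∈ spectrum ℂ R) ∧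
      ∀ F : ℂ → ℂ, ContinuousOn F (spectrum ℂ R) → inner ℂ ψ (cfc F R ψ) = ∫ w, F w ∂ν := by
  let ρ := RealRMK.rieszMeasure (quadraticFunctional hR ψ)
  have hemb : MeasurableEmbedding (Subtype.val : spectrum ℂ R → ℂ) :=
    MeasurableEmbedding.subtype_coe (spectrum.isCompact R).measurableSet
  have hreal : ∀ g : C(spectrum ℂ R, ℝ),
      inner ℂ ψ (cfcHom hR (complexify g) ψ) = ∫ x, (g x : ℂ) ∂ρ := fun g => by
    have := RealRMK.integral_rieszMeasure (quadraticFunctional hR ψ)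
      ⟨g, HasCompactSupport.of_compactSpace _⟩
    rw [integral_complex_ofReal, ← inner_cfcHom_complexify hR g ψ]
    exact congrArg Complex.ofReal this.symm
  refine ⟨ρ.map Subtype.val, inferInstance, ?_, fun F hF => ?_⟩
  · rw [hemb.ae_map_iff]
    exact Eventually.of_forall fun x => x.2
  · rw [hemb.integral_map, cfc_apply F R hR hF]
    set G : C(spectrum ℂ R, ℂ) := ⟨(spectrum ℂ R).domRestrict F, hF.domRestrict⟩ with hG
    let g₁ : C(spectrum ℂ R, ℝ) := ⟨fun x => (G x).re, by fun_prop⟩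
    let g₂ : C(spectrum ℂ R, ℝ) := ⟨fun x => (G x).im, by fun_prop⟩
    have hd : G = complexify g₁ + Complex.I • complexify g₂ := by
      ext x
      simp only [complexify, g₁, g₂, ContinuousMap.coe_mk, ContinuousMap.add_apply,
        ContinuousMap.smul_apply, smul_eq_mul]
      rw [mul_comm, Complex.re_add_im]
    have hint : ∀ g : C(spectrum ℂ R, ℝ), Integrable (fun x => (g x : ℂ)) ρ := fun g =>
      (BoundedContinuousFunction.mkOfCompact (complexify g)).integrable ρ
    rw [hd, map_add, map_smul, add_apply, smul_apply, inner_add_right, inner_smul_right,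
      hreal, hreal, ← integral_const_mul, ← integral_add (hint g₁) ((hint g₂).const_mul _)]
    refine integral_congr_ae (Eventually.of_forall fun x => ?_)
    change ((F x).re : ℂ) + Complex.I * ((F x).im : ℂ) = F x
    rw [mul_comm, Complex.re_add_im]

/-- A continuous function on `ℂ` that vanishes at `0` and tends to `1` elsewhere as `δ → 0`. -/
noncomputable def cutoff (δ : ℝ) (w : ℂ) : ℝ := ‖w‖ ^ 2 / (‖w‖ ^ 2 + δ ^ 2)

variable {δ : ℝ}

lemma continuous_cutoff (hδ : 0 < δ) : Continuous (cutoff δ) := by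
  unfold cutoff
  exact (by fun_prop : Continuous fun w : ℂ => ‖w‖ ^ 2).div (by fun_prop) fun w => by positivity

lemma cutoff_nonneg (w : ℂ) : 0 ≤ cutoff δ w := by
  unfold cutoff
  positivity

lemma cutoff_le_one (w : ℂ) : cutoff δ w ≤ 1 :=
  div_le_one_of_le₀ (by linarith [sq_nonneg δ]) (by positivity)

lemma norm_cutoff_sub_one_mul_le (hδ : 0 < δ) (w : ℂ) : ‖((cutoff δ w : ℂ) - 1) * w‖ ≤ δ := by
  have h1 : ‖(cutoff δ w : ℂ) - 1‖ = δ ^ 2 / (‖w‖ ^ 2 + δ ^ 2) := by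
    have h2 : cutoff δ w - 1 = -(δ ^ 2 / (‖w‖ ^ 2 + δ ^ 2)) := by
      unfold cutoff
      field_simp
      ring
    rw [← Complex.ofReal_one, ← Complex.ofReal_sub, Complex.norm_real, h2, norm_neg,
      Real.norm_of_nonneg (by positivity)]
  rw [norm_mul, h1, div_mul_eq_mul_div, div_le_iff₀ (by positivity)]
  nlinarith [sq_nonneg (‖w‖ - δ), norm_nonneg w]

lemma tendsto_cutoff {w : ℂ} (hw : w ≠ 0) :
    Tendsto (fun n : ℕ => cutoff (1 / ((n : ℝ) + 1)) w) atTop (𝓝 1) := by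
  have hw' : ‖w‖ ≠ 0 := norm_ne_zero_iff.mpr hw
  have h1 : ‖w‖ ^ 2 / (‖w‖ ^ 2 + 0 ^ 2) = (1 : ℝ) := by
    field_simp
    ring
  have h2 := (tendsto_one_div_add_atTop_nhds_zero_nat (𝕜 := ℝ)).pow 2
  have h3 := (tendsto_const_nhds (x := ‖w‖ ^ 2)).div (tendsto_const_nhds.add h2)
    (by positivity : ‖w‖ ^ 2 + 0 ^ 2 ≠ 0)
  rwa [h1] at h3

lemma tendsto_cfc_cutoff (hR : IsStarNormal R) (hd : DenseRange R) (ψ : H) :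
    Tendsto (fun n : ℕ => cfc (fun w => (cutoff (1 / ((n : ℝ) + 1)) w : ℂ)) R ψ) atTop (𝓝 ψ) := by
  have hpos : ∀ n : ℕ, (0 : ℝ) < 1 / ((n : ℝ) + 1) := fun n => by positivity
  have hc : ∀ n : ℕ, Continuous fun w => (cutoff (1 / ((n : ℝ) + 1)) w : ℂ) := fun n =>
    Complex.continuous_ofReal.comp (continuous_cutoff (hpos n))
  let T : ℕ → H →L[ℂ] H := fun n => cfc (fun w => (cutoff (1 / ((n : ℝ) + 1)) w : ℂ) - 1) R
  have hT : ∀ n, T n = cfc (fun w => (cutoff (1 / ((n : ℝ) + 1)) w : ℂ)) R - 1 := fun n => by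
    rw [← cfc_const_one ℂ R, ← cfc_sub _ _ R (hc n).continuousOn]
  have hT1 : ∀ n, ‖T n‖ ≤ 1 := fun n => by
    refine norm_cfc_le zero_le_one fun w _ => ?_
    rw [← Complex.ofReal_one, ← Complex.ofReal_sub, Complex.norm_real, Real.norm_eq_abs, abs_le]
    constructor <;> linarith [cutoff_nonneg (δ := 1 / ((n : ℝ) + 1)) w,
      cutoff_le_one (δ := 1 / ((n : ℝ) + 1)) w]
  have hT2 : ∀ n, ‖T n * R‖ ≤ 1 / ((n : ℝ) + 1) := fun n => by
    have : T n * R = cfc (fun w => ((cutoff (1 / ((n : ℝ) + 1)) w : ℂ) - 1) * w) R := by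
      rw [cfc_mul (fun w => (cutoff (1 / ((n : ℝ) + 1)) w : ℂ) - 1) (fun w => w) R
        ((hc n).sub continuous_const).continuousOn continuous_id.continuousOn, cfc_id' ℂ R]
    rw [this]
    exact norm_cfc_le (hpos n).le fun w _ => norm_cutoff_sub_one_mul_le (hpos n) w
  have key := tendsto_zero_of_denseRange hT1 hd (fun φ => ?_) ψ
  · have := key.add_const ψ
    rw [zero_add] at this
    refine this.congr fun n => ?_
    rw [hT]
    simp
  · refine squeeze_zero_norm (a := fun n : ℕ => 1 / ((n : ℝ) + 1) * ‖φ‖) (fun n => ?_) ?_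
    · exact (T n * R).le_of_opNorm_le (hT2 n) φ
    · simpa using (tendsto_one_div_add_atTop_nhds_zero_nat (𝕜 := ℝ)).mul_const ‖φ‖

lemma ae_ne_zero_of_inner_cfc (hR : IsStarNormal R) (hd : DenseRange R) {ψ : H} {ν : Measure ℂ}
    [IsFiniteMeasure ν]
    (hν : ∀ F : ℂ → ℂ, ContinuousOn F (spectrum ℂ R) → inner ℂ ψ (cfc F R ψ) = ∫ w, F w ∂ν) :
    ∀ᵐ w ∂ν, w ≠ 0 := by
  have hpos : ∀ n : ℕ, (0 : ℝ) < 1 / ((n : ℝ) + 1) := fun n => by positivity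
  have hlim : Tendsto (fun n : ℕ => ∫ w, (1 - cutoff (1 / ((n : ℝ) + 1)) w) ∂ν) atTop (𝓝 0) := by
    have h1 := (tendsto_const_nhds (x := ψ)).sub (tendsto_cfc_cutoff hR hd ψ)
    rw [sub_self] at h1
    have h2 := (tendsto_const_nhds (x := ψ)).inner (𝕜 := ℂ) h1
    rw [inner_zero_right] at h2
    have h3 := (Complex.continuous_re.tendsto 0).comp h2
    refine h3.congr fun n => ?_
    have hc : Continuous fun w => (cutoff (1 / ((n : ℝ) + 1)) w : ℂ) :=
      Complex.continuous_ofReal.comp (continuous_cutoff (hpos n))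
    have h4 : ψ - cfc (fun w => (cutoff (1 / ((n : ℝ) + 1)) w : ℂ)) R ψ
        = cfc (fun w => ((1 - cutoff (1 / ((n : ℝ) + 1)) w : ℝ) : ℂ)) R ψ := by
      have : cfc (fun w => ((1 - cutoff (1 / ((n : ℝ) + 1)) w : ℝ) : ℂ)) R
          = 1 - cfc (fun w => (cutoff (1 / ((n : ℝ) + 1)) w : ℂ)) R := by
        rw [← cfc_const_one ℂ R, ← cfc_sub _ _ R continuous_const.continuousOn hc.continuousOn]
        simp
      rw [this]
      simp
    rw [Function.comp_apply, h4, hν _ (Continuous.continuousOn (by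
      have := continuous_cutoff (hpos n)
      fun_prop)), integral_complex_ofReal, Complex.ofReal_re]
  have hle : ∀ n : ℕ, ν.real {0} ≤ ∫ w, (1 - cutoff (1 / ((n : ℝ) + 1)) w) ∂ν := fun n => by
    have hint : Integrable (fun w => 1 - cutoff (1 / ((n : ℝ) + 1)) w) ν := by
      refine (integrable_const (1 : ℝ)).mono'
        (continuous_const.sub (continuous_cutoff (hpos n))).aestronglyMeasurable
        (Eventually.of_forall fun w => ?_)
      rw [Real.norm_eq_abs, abs_le]
      constructor <;> linarith [cutoff_nonneg (δ := 1 / ((n : ℝ) + 1)) w,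
        cutoff_le_one (δ := 1 / ((n : ℝ) + 1)) w]
    have := setIntegral_le_integral (s := {0}) hint
      (Eventually.of_forall fun w => sub_nonneg.mpr (cutoff_le_one w))
    rw [integral_singleton] at this
    simpa [cutoff] using this
  have h0 : ν.real {0} = 0 :=
    le_antisymm (ge_of_tendsto' hlim hle) measureReal_nonneg
  rw [measureReal_eq_zero_iff] at h0
  rw [ae_iff]
  simpa using h0

end NormalOperator

section SpectralMeasure

variable {H : Type*} [NormedAddCommGroup H] [InnerProductSpace ℂ H] [CompleteSpace H]
  {A : H →ₗ.[ℂ] H} {z ζ : ℂ} {R S : H →L[ℂ] H}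

omit [CompleteSpace H] in
lemma IsSpectralMeasure.spectralMeasure_eq {ψ : H} {μ : Measure ℝ} (hμ : IsSpectralMeasure A ψ μ) :
    spectralMeasure A ψ = μ := by
  have h : ∃ μ : Measure ℝ, IsSpectralMeasure A ψ μ := ⟨μ, hμ⟩
  rw [spectralMeasure, dif_pos h]
  have h' := h.choose_spec
  have := h'.1
  have := hμ.1
  exact measure_ext_of_borelTransform fun z hz => by rw [← h'.2 z hz, hμ.2 z hz]

lemma IsResolventAt.one_sub_mul_ne_zero (hA : IsSelfAdjoint A) (hR : IsResolventAt A z R)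
    (hζ : ζ.im ≠ 0) {w : ℂ} (hw : w ∈ spectrum ℂ R) : 1 - (ζ - z) * w ≠ 0 := by
  intro h
  have hw0 : w ≠ 0 := by
    rintro rfl
    simp at h
  refine hζ (im_eq_zero_of_mem_opSpectrum hA ?_)
  have e : ζ = z + w⁻¹ := by
    field_simp
    linear_combination -h
  rw [e]
  exact hR.mem_opSpectrum_of_mem_spectrum hw hw0

/-- Every nonreal resolvent is a continuous function of a given resolvent. -/
lemma IsResolventAt.eq_cfc (hA : IsSelfAdjoint A) (hR : IsResolventAt A z R)
    (hS : IsResolventAt A ζ S) (hζ : ζ.im ≠ 0) :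
    S = cfc (fun w => w * (1 - (ζ - z) * w)⁻¹) R := by
  have hn := hR.isStarNormal hA
  have hne := fun w (hw : w ∈ spectrum ℂ R) => hR.one_sub_mul_ne_zero hA hζ hw
  have hc : ContinuousOn (fun w : ℂ => (1 - (ζ - z) * w)⁻¹) (spectrum ℂ R) :=
    ContinuousOn.inv₀ (by fun_prop) hne
  have h1 : S * (1 - (ζ - z) • R) = R := by
    rw [mul_sub, mul_one, mul_smul_comm, ← hS.sub_eq hR, sub_sub_cancel]
  have h2 : (1 - (ζ - z) • R) * cfc (fun w : ℂ => (1 - (ζ - z) * w)⁻¹) R = 1 := by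
    have e : 1 - (ζ - z) • R = cfc (fun w : ℂ => 1 - (ζ - z) * w) R := by
      rw [cfc_sub (fun _ => (1 : ℂ)) (fun w => (ζ - z) * w) R, cfc_const_one ℂ R,
        cfc_const_mul_id (ζ - z) R]
    rw [e, ← cfc_mul _ _ R (by fun_prop) hc, ← cfc_const_one ℂ R]
    exact cfc_congr fun w hw => mul_inv_cancel₀ (hne w hw)
  rw [cfc_mul (fun w => w) _ R continuous_id.continuousOn hc, cfc_id' ℂ R]
  calc S = S * ((1 - (ζ - z) • R) * cfc (fun w : ℂ => (1 - (ζ - z) * w)⁻¹) R) := by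
        rw [h2, mul_one]
    _ = _ := by rw [← mul_assoc, h1]

/-- The spectral theorem: the spectral measures of a self-adjoint operator exist, are concentrated
on the spectrum and represent the continuous functions of the resolvent. -/
lemma IsResolventAt.spectralMeasure_spec (hA : IsSelfAdjoint A) (hR : IsResolventAt A z R)
    (ψ : H) :
    IsFiniteMeasure (spectralMeasure A ψ) ∧
    (∀ᵐ t ∂(spectralMeasure A ψ), ((t : ℝ) : ℂ) ∈ opSpectrum A) ∧
    (∀ᵐ t ∂(spectralMeasure A ψ), (((t : ℝ) : ℂ) - z)⁻¹ ∈ spectrum ℂ R) ∧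
    ∀ F : ℂ → ℂ, Continuous F →
      inner ℂ ψ (cfc F R ψ) = ∫ t : ℝ, F ((t : ℂ) - z)⁻¹ ∂(spectralMeasure A ψ) := by
  have hn := hR.isStarNormal hA
  obtain ⟨ν, hfin, hsp, hν⟩ := exists_measure_inner_cfc hn ψ
  have hne := ae_ne_zero_of_inner_cfc hn (hR.denseRange hA) hν
  have hmeas : Measurable fun w : ℂ => (z + w⁻¹).re := by fun_prop
  have hre : ∀ w ∈ spectrum ℂ R, w ≠ 0 → (((z + w⁻¹).re : ℝ) : ℂ) = z + w⁻¹ := fun w hw hw0 => by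
    have h := im_eq_zero_of_mem_opSpectrum hA (hR.mem_opSpectrum_of_mem_spectrum hw hw0)
    rw [← Complex.conj_eq_iff_re, Complex.conj_eq_iff_im, h]
  have hinv : ∀ w ∈ spectrum ℂ R, w ≠ 0 → ((((z + w⁻¹).re : ℝ) : ℂ) - z)⁻¹ = w :=
    fun w hw hw0 => by rw [hre w hw hw0, add_sub_cancel_left, inv_inv]
  have hμ : IsSpectralMeasure A ψ (ν.map fun w : ℂ => (z + w⁻¹).re) := by
    refine ⟨inferInstance, fun ζ hζ => ?_⟩
    have hS := isResolventAt_opResolvent (mem_opResolventSet_of_im_ne_zero hA hζ)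
    have h1 := fun w (hw : w ∈ spectrum ℂ R) => hR.one_sub_mul_ne_zero hA hζ hw
    have hc : ContinuousOn (fun w : ℂ => w * (1 - (ζ - z) * w)⁻¹) (spectrum ℂ R) :=
      ContinuousOn.mul continuous_id.continuousOn (ContinuousOn.inv₀ (by fun_prop) h1)
    have hk : Continuous fun t : ℝ => ((t : ℂ) - ζ)⁻¹ := (cauchyKernel ζ hζ).continuous
    rw [hR.eq_cfc hA hS hζ, hν _ hc, integral_map hmeas.aemeasurable
      hk.aestronglyMeasurable]
    refine integral_congr_ae ?_
    filter_upwards [hsp, hne] with w hw hw0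
    have h2 := h1 w hw
    rw [hre w hw hw0]
    have h3 : z + w⁻¹ - ζ = (1 - (ζ - z) * w) * w⁻¹ := by
      field_simp
      ring
    rw [h3, mul_inv, inv_inv, mul_comm]
  rw [hμ.spectralMeasure_eq]
  have h1 : ∀ᵐ t ∂(ν.map fun w : ℂ => (z + w⁻¹).re),
      (((t : ℝ) : ℂ) - z)⁻¹ ∈ spectrum ℂ R ∧ ((t : ℂ) - z)⁻¹ ≠ 0 := by
    have hcl : MeasurableSet {t : ℝ | ((t : ℂ) - z)⁻¹ ∈ spectrum ℂ R ∧ ((t : ℂ) - z)⁻¹ ≠ 0} := by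
      have hm : Measurable fun t : ℝ => ((t : ℂ) - z)⁻¹ := by fun_prop
      exact (hm (spectrum.isCompact R).measurableSet).inter
        (hm (measurableSet_singleton 0).compl)
    rw [ae_map_iff hmeas.aemeasurable hcl]
    filter_upwards [hsp, hne] with w hw hw0
    rw [hinv w hw hw0]
    exact ⟨hw, hw0⟩
  refine ⟨inferInstance, ?_, h1.mono fun t ht => ht.1, fun F hF => ?_⟩
  · filter_upwards [h1] with t ht
    have := hR.mem_opSpectrum_of_mem_spectrum ht.1 ht.2
    rwa [inv_inv, add_sub_cancel] at this
  · have hm : Measurable fun t : ℝ => F ((t : ℂ) - z)⁻¹ :=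
      hF.measurable.comp (by fun_prop)
    rw [hν F hF.continuousOn, integral_map hmeas.aemeasurable hm.aestronglyMeasurable]
    refine integral_congr_ae ?_
    filter_upwards [hsp, hne] with w hw hw0
    rw [hinv w hw hw0]

lemma IsResolventAt.norm_cfc_apply_sq (hA : IsSelfAdjoint A) (hR : IsResolventAt A z R)
    {F : ℂ → ℂ} (hF : Continuous F) (ψ : H) :
    ‖cfc F R ψ‖ ^ 2 = ∫ t : ℝ, ‖F ((t : ℂ) - z)⁻¹‖ ^ 2 ∂(spectralMeasure A ψ) := by
  have hn := hR.isStarNormal hA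
  have h1 := (hR.spectralMeasure_spec hA ψ).2.2.2 (fun w => star (F w) * F w) (by fun_prop)
  rw [cfc_mul _ _ R (by fun_prop) hF.continuousOn, cfc_star, mul_apply_eq_comp,
    ContinuousLinearMap.star_eq_adjoint, ContinuousLinearMap.adjoint_inner_right,
    inner_self_eq_norm_sq_to_K] at h1
  have h2 : ∀ w, star (F w) * F w = ((‖F w‖ ^ 2 : ℝ) : ℂ) := fun w => by
    rw [RCLike.star_def, Complex.conj_mul']
    push_cast
    rfl
  simp_rw [h2] at h1
  rw [integral_complex_ofReal] at h1
  exact Complex.ofReal_injective (by simpa using h1)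

/-- A bounded function of a self-adjoint operator, composed with the resolvent. -/
lemma IsResolventAt.functionOf_spec (hA : IsSelfAdjoint A) (hR : IsResolventAt A z R)
    {f : ℝ → ℂ} {M : ℝ} (hM : 0 ≤ M) (hf : ∀ t : ℝ, (t : ℂ) ∈ opSpectrum A → ‖f t‖ ≤ M)
    {G : ℂ → ℂ} (hG : Continuous G)
    (hGf : ∀ t : ℝ, (t : ℂ) ∈ opSpectrum A → G ((t : ℂ) - z)⁻¹ = ((t : ℂ) - z)⁻¹ * f t) :
    functionOf A f * R = cfc G R ∧ ‖functionOf A f‖ ≤ M := by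
  have hn := hR.isStarNormal hA
  have hd := hR.denseRange hA
  have hz : z ∉ opSpectrum A := fun h => h ⟨R, hR⟩
  have hb : ∀ φ, ‖cfc G R φ‖ ≤ M * ‖R φ‖ := fun φ => by
    obtain ⟨_, hsp, hspR, -⟩ := hR.spectralMeasure_spec hA φ
    have h1 := hR.norm_cfc_apply_sq hA hG φ
    have h2 := hR.norm_cfc_apply_sq hA continuous_id φ
    rw [cfc_id ℂ R] at h2
    have hint : ∀ F : ℂ → ℂ, Continuous F →
        Integrable (fun t : ℝ => ‖F ((t : ℂ) - z)⁻¹‖ ^ 2) (spectralMeasure A φ) := fun F hF => by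
      obtain ⟨C, hC⟩ := (spectrum.isCompact R).exists_bound_of_continuousOn
        (f := fun w => ‖F w‖ ^ 2) (by fun_prop)
      have hm : Measurable fun t : ℝ => ‖F ((t : ℂ) - z)⁻¹‖ ^ 2 :=
        (by fun_prop : Continuous fun w => ‖F w‖ ^ 2).measurable.comp (by fun_prop)
      refine (integrable_const C).mono' hm.aestronglyMeasurable ?_
      filter_upwards [hspR] with t ht using hC _ ht
    refine le_of_sq_le_sq ?_ (by positivity)
    rw [mul_pow, h1, h2, ← integral_const_mul]
    refine integral_mono_ae (hint G hG) ((hint id continuous_id).const_mul _) ?_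
    filter_upwards [hsp] with t ht
    rw [hGf t ht, norm_mul, mul_pow, mul_comm]
    exact mul_le_mul_of_nonneg_right (pow_le_pow_left₀ (norm_nonneg _) (hf t ht) 2) (by positivity)
  let T : H →L[ℂ] H := (cfc G R).toLinearMap.extendOfNorm R.toLinearMap
  have hTR : ∀ φ, T (R φ) = cfc G R φ := fun φ => LinearMap.extendOfNorm_eq hd ⟨M, hb⟩ φ
  have hTM : ‖T‖ ≤ M := LinearMap.opNorm_extendOfNorm_le hd hM hb
  have hT : IsFunctionOf A f T := fun ψ => by
    obtain ⟨_, hsp, -, hF⟩ := hR.spectralMeasure_spec hA ψ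
    have hr : (spectralMeasure A ψ).restrict {t : ℝ | (t : ℂ) ∈ opSpectrum A}
        = spectralMeasure A ψ := Measure.restrict_eq_self_of_ae_mem hsp
    rw [hr]
    let δ : ℕ → ℝ := fun n => 1 / ((n : ℝ) + 1)
    have hδ : ∀ n, 0 < δ n := fun n => by positivity
    let e : ℕ → ℂ → ℂ := fun n w => conj w * (((‖w‖ ^ 2 + δ n ^ 2)⁻¹ : ℝ) : ℂ)
    have he : ∀ n, Continuous (e n) := fun n => by
      have : Continuous fun w : ℂ => (‖w‖ ^ 2 + δ n ^ 2)⁻¹ :=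
        (by fun_prop : Continuous fun w : ℂ => ‖w‖ ^ 2 + δ n ^ 2).inv₀ fun w =>
          (add_pos_of_nonneg_of_pos (sq_nonneg _) (pow_pos (hδ n) 2)).ne'
      fun_prop
    have hwe : ∀ n w, w * e n w = (cutoff (δ n) w : ℂ) := fun n w => by
      simp only [e, cutoff, div_eq_mul_inv]
      rw [← mul_assoc, Complex.mul_conj']
      push_cast
      rfl
    have hTe : ∀ n, T (cfc (fun w => (cutoff (δ n) w : ℂ)) R ψ)
        = cfc (fun w => G w * e n w) R ψ := fun n => by
      have h1 : cfc (fun w => (cutoff (δ n) w : ℂ)) R = R * cfc (e n) R := by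
        simp_rw [← hwe n]
        rw [cfc_mul (fun w => w) (e n) R continuous_id.continuousOn (he n).continuousOn,
          cfc_id' ℂ R]
      rw [h1, mul_apply_eq_comp, hTR,
        cfc_mul G (e n) R hG.continuousOn (he n).continuousOn, mul_apply_eq_comp]
    have hlim1 := (tendsto_const_nhds (x := ψ)).inner (𝕜 := ℂ)
      ((T.continuous.tendsto ψ).comp (tendsto_cfc_cutoff hn hd ψ))
    refine tendsto_nhds_unique hlim1 ?_
    have hlim2 : Tendsto (fun n => ∫ t : ℝ, G ((t : ℂ) - z)⁻¹ * e n ((t : ℂ) - z)⁻¹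
        ∂(spectralMeasure A ψ)) atTop (𝓝 (∫ t, f t ∂(spectralMeasure A ψ))) := by
      have hGe : ∀ n (t : ℝ), (t : ℂ) ∈ opSpectrum A →
          G ((t : ℂ) - z)⁻¹ * e n ((t : ℂ) - z)⁻¹ = cutoff (δ n) ((t : ℂ) - z)⁻¹ * f t :=
        fun n t ht => by rw [hGf t ht, ← hwe n]; ring
      refine tendsto_integral_of_dominated_convergence (fun _ => M) (fun n => ?_)
        (integrable_const _) (fun n => ?_) ?_
      · exact ((hG.mul (he n)).measurable.comp
          (by fun_prop : Measurable fun t : ℝ => ((t : ℂ) - z)⁻¹)).aestronglyMeasurable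
      · filter_upwards [hsp] with t ht
        rw [hGe n t ht, norm_mul, Complex.norm_real, Real.norm_of_nonneg (cutoff_nonneg _)]
        exact (mul_le_of_le_one_left (norm_nonneg _) (cutoff_le_one _)).trans (hf t ht)
      · filter_upwards [hsp] with t ht
        have ht0 : ((t : ℂ) - z)⁻¹ ≠ 0 := by
          refine inv_ne_zero (sub_ne_zero.mpr ?_)
          rintro rfl
          exact hz ht
        simp_rw [fun n => hGe n t ht]
        have := ((Complex.continuous_ofReal.tendsto 1).comp (tendsto_cutoff ht0)).mul_const (f t)
        rwa [Complex.ofReal_one, one_mul] at this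
    refine hlim2.congr fun n => ?_
    rw [Function.comp_apply, hTe n, hF (fun w => G w * e n w) (hG.mul (he n))]
  have hfT : functionOf A f = T := by
    have h : ∃ T : H →L[ℂ] H, IsFunctionOf A f T := ⟨T, hT⟩
    rw [functionOf, dif_pos h]
    have h' := h.choose_spec
    apply ContinuousLinearMap.coe_injective
    rw [← ext_inner_map]
    intro ψ
    have := (h' ψ).trans (hT ψ).symm
    have h2 := congrArg conj this
    rwa [inner_conj_symm, inner_conj_symm] at h2
  rw [hfT]
  exact ⟨ContinuousLinearMap.ext hTR, hTM⟩

end SpectralMeasure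

section CfcConvergence

lemma cfc_eq_cfcHomSuperset {𝓐 : Type*} [CStarAlgebra 𝓐] {a : 𝓐} (ha : IsStarNormal a)
    {s : Set ℂ} (hs : spectrum ℂ a ⊆ s) {F : ℂ → ℂ} (hF : Continuous F) :
    cfc F a = cfcHomSuperset ha hs (.restrict s ⟨F, hF⟩) := by
  rw [cfc_apply F a ha hF.continuousOn]
  rfl

variable {H : Type*} [NormedAddCommGroup H] [InnerProductSpace ℂ H] [CompleteSpace H]
  {K : ℕ → Type*} [∀ n, NormedAddCommGroup (K n)] [∀ n, InnerProductSpace ℂ (K n)]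
  [∀ n, CompleteSpace (K n)]
  {J : ∀ n, H →L[ℂ] K n} {C : ℝ} {R : H →L[ℂ] H} {Rn : ∀ n, K n →L[ℂ] K n} {s : Set ℂ}

lemma norm_adjoint_comp_comp_le (hC : ∀ n, ‖J n‖ ≤ C) (n : ℕ) (T : K n →L[ℂ] K n) :
    ‖ContinuousLinearMap.adjoint (J n) ∘L T ∘L J n‖ ≤ C * C * ‖T‖ := by
  have hC0 : 0 ≤ C := (norm_nonneg _).trans (hC n)
  calc _ ≤ ‖ContinuousLinearMap.adjoint (J n)‖ * (‖T‖ * ‖J n‖) :=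
        (ContinuousLinearMap.opNorm_comp_le _ _).trans
          (mul_le_mul_of_nonneg_left (ContinuousLinearMap.opNorm_comp_le _ _) (norm_nonneg _))
    _ ≤ C * (‖T‖ * C) := by
        rw [LinearIsometryEquiv.norm_map]
        gcongr <;> exact hC n
    _ = _ := by ring

/-- Norm convergence passes from a normal operator to its continuous functions. -/
lemma tendsto_cfc_of_tendsto (hC : ∀ n, ‖J n‖ ≤ C)
    (h1 : Tendsto (fun n => ‖ContinuousLinearMap.adjoint (J n) ∘L J n
      - ContinuousLinearMap.id ℂ H‖) atTop (𝓝 0))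
    (h2 : Tendsto (fun n => ‖J n ∘L ContinuousLinearMap.adjoint (J n)
      - ContinuousLinearMap.id ℂ (K n)‖) atTop (𝓝 0))
    (hR : IsStarNormal R) (hRn : ∀ n, IsStarNormal (Rn n)) (hs : IsCompact s)
    (hRs : spectrum ℂ R ⊆ s) (hRns : ∀ n, spectrum ℂ (Rn n) ⊆ s)
    (h : Tendsto (fun n => ContinuousLinearMap.adjoint (J n) ∘L Rn n ∘L J n) atTop (𝓝 R))
    {F : ℂ → ℂ} (hF : Continuous F) :
    Tendsto (fun n => ContinuousLinearMap.adjoint (J n) ∘L cfc F (Rn n) ∘L J n) atTop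
      (𝓝 (cfc F R)) := by
  have : CompactSpace s := isCompact_iff_compactSpace.mp hs
  have hC0 : 0 ≤ C := (norm_nonneg _).trans (hC 0)
  rw [cfc_eq_cfcHomSuperset hR hRs hF]
  simp_rw [fun n => cfc_eq_cfcHomSuperset (hRn n) (hRns n) hF]
  generalize ContinuousMap.restrict s ⟨F, hF⟩ = G
  let Φ := cfcHomSuperset hR hRs
  let Φn := fun n => cfcHomSuperset (hRn n) (hRns n)
  have hΦ : ∀ G, ‖Φ G‖ ≤ ‖G‖ := fun G => NonUnitalStarAlgHom.norm_apply_le Φ G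
  have hΦn : ∀ n G, ‖Φn n G‖ ≤ ‖G‖ := fun n G => NonUnitalStarAlgHom.norm_apply_le (Φn n) G
  change Tendsto (fun n => ContinuousLinearMap.adjoint (J n) ∘L Φn n G ∘L J n) atTop (𝓝 (Φ G))
  have hid : Φ (.restrict s <| .id ℂ) = R := cfcHomSuperset_id hR hRs
  have hidn : ∀ n, Φn n (.restrict s <| .id ℂ) = Rn n := fun n => cfcHomSuperset_id (hRn n) (hRns n)
  induction G using ContinuousMap.induction_on_of_compact with
  | const r =>
    have e : ContinuousMap.const s r = algebraMap ℂ C(s, ℂ) r := rfl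
    rw [tendsto_iff_norm_sub_tendsto_zero]
    have h3 := h1.const_mul ‖r‖
    rw [mul_zero] at h3
    refine h3.congr fun n => ?_
    rw [e, AlgHomClass.commutes, AlgHomClass.commutes, ← norm_smul]
    congr 1
    ext ψ
    simp [Algebra.algebraMap_eq_smul_one, smul_sub]
  | id =>
    rw [hid]
    simpa only [hidn] using h
  | star_id =>
    rw [map_star, hid]
    have h3 := (continuous_star.tendsto R).comp h
    refine h3.congr fun n => ?_
    rw [map_star, hidn]
    simp only [Function.comp_apply, ContinuousLinearMap.star_eq_adjoint,
      ContinuousLinearMap.adjoint_comp, ContinuousLinearMap.adjoint_adjoint]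
    rfl
  | add f g hf hg =>
    rw [map_add]
    refine (hf.add hg).congr fun n => ?_
    rw [map_add]
    ext ψ
    simp
  | mul f g hf hg =>
    have herr : Tendsto (fun n => ContinuousLinearMap.adjoint (J n) ∘L
        (Φn n f * (J n ∘L ContinuousLinearMap.adjoint (J n) - ContinuousLinearMap.id ℂ (K n))
          * Φn n g) ∘L J n) atTop (𝓝 0) := by
      have h3 := h2.const_mul (C * C * (‖f‖ * ‖g‖))
      rw [mul_zero] at h3
      refine squeeze_zero_norm (fun n => ?_) h3
      refine (norm_adjoint_comp_comp_le hC n _).trans ?_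
      rw [mul_assoc (C * C)]
      refine mul_le_mul_of_nonneg_left ?_ (by positivity)
      calc _ ≤ ‖Φn n f‖ * ‖J n ∘L ContinuousLinearMap.adjoint (J n)
            - ContinuousLinearMap.id ℂ (K n)‖ * ‖Φn n g‖ :=
          (norm_mul_le _ _).trans (mul_le_mul_of_nonneg_right (norm_mul_le _ _) (norm_nonneg _))
        _ ≤ ‖f‖ * ‖J n ∘L ContinuousLinearMap.adjoint (J n)
            - ContinuousLinearMap.id ℂ (K n)‖ * ‖g‖ := by
          gcongr <;> exact hΦn n _
        _ = _ := by ring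
    rw [map_mul]
    have h4 := (hf.mul hg).sub herr
    rw [sub_zero] at h4
    refine h4.congr fun n => ?_
    rw [map_mul]
    ext ψ
    simp [mul_apply_eq_comp]
  | frequently f hf =>
    rw [Metric.tendsto_atTop]
    intro ε hε
    obtain ⟨g, hg, hgf⟩ := (hf.and_eventually
      (Metric.ball_mem_nhds f (by positivity : 0 < ε / (2 * (C * C + 1))))).exists
    obtain ⟨N, hN⟩ := Metric.tendsto_atTop.mp hg (ε / 2) (by positivity)
    refine ⟨N, fun n hn => ?_⟩
    have h3 := hN n hn
    rw [dist_eq_norm] at h3 ⊢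
    have e : ContinuousLinearMap.adjoint (J n) ∘L Φn n f ∘L J n - Φ f
        = (ContinuousLinearMap.adjoint (J n) ∘L Φn n (f - g) ∘L J n - Φ (f - g))
          + (ContinuousLinearMap.adjoint (J n) ∘L Φn n g ∘L J n - Φ g) := by
      rw [map_sub, map_sub]
      ext ψ
      simp only [sub_apply, add_apply, ContinuousLinearMap.comp_apply, map_sub]
      abel
    have h5 : ‖ContinuousLinearMap.adjoint (J n) ∘L Φn n (f - g) ∘L J n - Φ (f - g)‖ ≤ ε / 2 := by
      calc _ ≤ C * C * ‖Φn n (f - g)‖ + ‖Φ (f - g)‖ :=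
            (norm_sub_le _ _).trans (add_le_add_left (norm_adjoint_comp_comp_le hC n _) _)
        _ ≤ C * C * ‖f - g‖ + ‖f - g‖ :=
            add_le_add (mul_le_mul_of_nonneg_left (hΦn n _) (by positivity)) (hΦ _)
        _ = (C * C + 1) * dist g f := by rw [dist_comm, dist_eq_norm]; ring
        _ ≤ (C * C + 1) * (ε / (2 * (C * C + 1))) :=
            mul_le_mul_of_nonneg_left (Metric.mem_ball.mp hgf).le (by positivity)
        _ = ε / 2 := by field_simp
    rw [e]
    exact (norm_add_le _ _).trans_lt (by linarith)

section Strong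

omit [CompleteSpace H] in
lemma re_inner_self_eq (ψ : H) : (inner ℂ ψ ψ).re = ‖ψ‖ ^ 2 :=
  (norm_sq_eq_re_inner (𝕜 := ℂ) ψ).symm

variable (hJ : ∀ ψ : H, Tendsto (fun n => ‖ContinuousLinearMap.adjoint (J n) (J n ψ) - ψ‖)
  atTop (𝓝 0))

include hJ

lemma tendsto_inner_apply (ψ φ : H) :
    Tendsto (fun n => inner ℂ (J n ψ) (J n φ)) atTop (𝓝 (inner ℂ ψ φ)) := by
  have h1 := (tendsto_const_nhds (x := ψ)).inner (𝕜 := ℂ)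
    (tendsto_iff_norm_sub_tendsto_zero.mpr (hJ φ))
  exact h1.congr fun n => ContinuousLinearMap.adjoint_inner_right _ _ _

lemma tendsto_norm_sq_apply (ψ : H) : Tendsto (fun n => ‖J n ψ‖ ^ 2) atTop (𝓝 (‖ψ‖ ^ 2)) := by
  have h1 := (Complex.continuous_re.tendsto _).comp (tendsto_inner_apply hJ ψ ψ)
  rw [re_inner_self_eq] at h1
  exact h1.congr fun n => re_inner_self_eq (J n ψ)

omit [∀ n, CompleteSpace (K n)] [CompleteSpace H] hJ in
lemma tendsto_norm_sub_of_norm_sq {u v : ∀ n, K n} {a : ℝ}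
    (hu : Tendsto (fun n => ‖u n‖ ^ 2) atTop (𝓝 a)) (hv : Tendsto (fun n => ‖v n‖ ^ 2) atTop (𝓝 a))
    (huv : Tendsto (fun n => (inner ℂ (u n) (v n)).re) atTop (𝓝 a)) :
    Tendsto (fun n => ‖u n - v n‖) atTop (𝓝 0) := by
  have h1 := ((hu.sub (huv.const_mul 2)).add hv).sqrt
  have h2 : a - 2 * a + a = 0 := by ring
  rw [h2, Real.sqrt_zero] at h1
  refine h1.congr fun n => ?_
  have := norm_sub_sq (𝕜 := ℂ) (u n) (v n)
  rw [← Real.sqrt_sq (norm_nonneg (u n - v n)), this]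
  rfl

lemma tendsto_resolvent_of_im_ne_zero {z : ℂ} (hz : z.im ≠ 0)
    (him : ∀ ψ, (inner ℂ ψ (R ψ)).im = z.im * ‖R ψ‖ ^ 2)
    (himn : ∀ n ψ, (inner ℂ ψ (Rn n ψ)).im = z.im * ‖Rn n ψ‖ ^ 2)
    (h : ∀ ψ, Tendsto (fun n => ‖ContinuousLinearMap.adjoint (J n) (Rn n (J n ψ)) - R ψ‖)
      atTop (𝓝 0)) (ψ : H) :
    Tendsto (fun n => ‖Rn n (J n ψ) - J n (R ψ)‖) atTop (𝓝 0) := by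
  have h' := tendsto_iff_norm_sub_tendsto_zero.mpr (h ψ)
  refine tendsto_norm_sub_of_norm_sq (a := ‖R ψ‖ ^ 2) ?_ (tendsto_norm_sq_apply hJ _) ?_
  · have h1 := ((Complex.continuous_im.tendsto _).comp
      ((tendsto_const_nhds (x := ψ)).inner (𝕜 := ℂ) h')).const_mul z.im⁻¹
    rw [him, inv_mul_cancel_left₀ hz] at h1
    refine h1.congr fun n => ?_
    rw [Function.comp_apply, ContinuousLinearMap.adjoint_inner_right, himn,
      inv_mul_cancel_left₀ hz]
  · have h1 := (Complex.continuous_re.tendsto _).comp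
      (h'.inner (𝕜 := ℂ) (tendsto_const_nhds (x := R ψ)))
    rw [re_inner_self_eq] at h1
    refine h1.congr fun n => ?_
    rw [Function.comp_apply, ContinuousLinearMap.adjoint_inner_left]

omit hJ in
lemma norm_adjoint_apply_eq (hR : IsStarNormal R) (ψ : H) :
    ‖ContinuousLinearMap.adjoint R ψ‖ ^ 2 = ‖R ψ‖ ^ 2 := by
  have h : ContinuousLinearMap.adjoint R * R = R * ContinuousLinearMap.adjoint R :=
    hR.star_comm_self
  have h1 := congrArg (fun T : H →L[ℂ] H => (inner ℂ ψ (T ψ)).re) h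
  simp only [mul_apply_eq_comp, ContinuousLinearMap.adjoint_inner_right] at h1
  rw [← ContinuousLinearMap.adjoint_inner_left R (ContinuousLinearMap.adjoint R ψ) ψ,
    re_inner_self_eq, re_inner_self_eq] at h1
  exact h1.symm

lemma tendsto_adjoint_of_isStarNormal (hC : ∀ n, ‖J n‖ ≤ C) (hR : IsStarNormal R)
    (hRn : ∀ n, IsStarNormal (Rn n))
    (h : ∀ ψ, Tendsto (fun n => ‖Rn n (J n ψ) - J n (R ψ)‖) atTop (𝓝 0)) (ψ : H) :
    Tendsto (fun n => ‖ContinuousLinearMap.adjoint (Rn n) (J n ψ)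
      - J n (ContinuousLinearMap.adjoint R ψ)‖) atTop (𝓝 0) := by
  refine tendsto_norm_sub_of_norm_sq (a := ‖ContinuousLinearMap.adjoint R ψ‖ ^ 2) ?_
    (tendsto_norm_sq_apply hJ _) ?_
  · simp_rw [fun n => norm_adjoint_apply_eq (hRn n) (J n ψ), norm_adjoint_apply_eq hR ψ]
    have h1 : Tendsto (fun n => ‖Rn n (J n ψ)‖ - ‖J n (R ψ)‖) atTop (𝓝 0) :=
      squeeze_zero_norm (fun n => abs_norm_sub_norm_le _ _) (h ψ)
    have h2 : Tendsto (fun n => ‖J n (R ψ)‖) atTop (𝓝 ‖R ψ‖) := by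
      have := (tendsto_norm_sq_apply hJ (R ψ)).sqrt
      simpa only [Real.sqrt_sq (norm_nonneg _)] using this
    have h3 := (h1.add h2).pow 2
    simpa only [sub_add_cancel, zero_add] using h3
  · have h1 : Tendsto (fun n => inner ℂ (J n ψ) (Rn n (J n (ContinuousLinearMap.adjoint R ψ))
        - J n (R (ContinuousLinearMap.adjoint R ψ)))) atTop (𝓝 0) := by
      have h2 := (h (ContinuousLinearMap.adjoint R ψ)).const_mul (C * ‖ψ‖)
      rw [mul_zero] at h2
      exact squeeze_zero_norm (fun n => (norm_inner_le_norm _ _).trans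
        (mul_le_mul_of_nonneg_right ((J n).le_of_opNorm_le (hC n) ψ) (norm_nonneg _))) h2
    have h2 := (Complex.continuous_re.tendsto _).comp
      (h1.add (tendsto_inner_apply hJ ψ (R (ContinuousLinearMap.adjoint R ψ))))
    rw [zero_add, ← ContinuousLinearMap.adjoint_inner_left, re_inner_self_eq] at h2
    refine h2.congr fun n => ?_
    rw [Function.comp_apply, ← inner_add_right, sub_add_cancel,
      ContinuousLinearMap.adjoint_inner_left]

/-- Strong convergence passes from a normal operator to its continuous functions. -/
lemma tendsto_cfc_apply_of_tendsto (hC : ∀ n, ‖J n‖ ≤ C)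
    (hR : IsStarNormal R) (hRn : ∀ n, IsStarNormal (Rn n)) (hs : IsCompact s)
    (hRs : spectrum ℂ R ⊆ s) (hRns : ∀ n, spectrum ℂ (Rn n) ⊆ s)
    (h : ∀ ψ, Tendsto (fun n => ‖Rn n (J n ψ) - J n (R ψ)‖) atTop (𝓝 0))
    {F : ℂ → ℂ} (hF : Continuous F) (ψ : H) :
    Tendsto (fun n => ‖cfc F (Rn n) (J n ψ) - J n (cfc F R ψ)‖) atTop (𝓝 0) := by
  have : CompactSpace s := isCompact_iff_compactSpace.mp hs
  have hC0 : 0 ≤ C := (norm_nonneg _).trans (hC 0)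
  rw [cfc_eq_cfcHomSuperset hR hRs hF]
  simp_rw [fun n => cfc_eq_cfcHomSuperset (hRn n) (hRns n) hF]
  generalize ContinuousMap.restrict s ⟨F, hF⟩ = G
  let Φ := cfcHomSuperset hR hRs
  let Φn := fun n => cfcHomSuperset (hRn n) (hRns n)
  have hΦ : ∀ G, ‖Φ G‖ ≤ ‖G‖ := fun G => NonUnitalStarAlgHom.norm_apply_le Φ G
  have hΦn : ∀ n G, ‖Φn n G‖ ≤ ‖G‖ := fun n G => NonUnitalStarAlgHom.norm_apply_le (Φn n) G
  change Tendsto (fun n => ‖Φn n G (J n ψ) - J n (Φ G ψ)‖) atTop (𝓝 0)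
  have hid : Φ (.restrict s <| .id ℂ) = R := cfcHomSuperset_id hR hRs
  have hidn : ∀ n, Φn n (.restrict s <| .id ℂ) = Rn n := fun n => cfcHomSuperset_id (hRn n) (hRns n)
  induction G using ContinuousMap.induction_on_of_compact generalizing ψ with
  | const r =>
    have e : ContinuousMap.const s r = algebraMap ℂ C(s, ℂ) r := rfl
    refine tendsto_const_nhds.congr fun n => ?_
    rw [e, AlgHomClass.commutes, AlgHomClass.commutes]
    simp [Algebra.algebraMap_eq_smul_one]
  | id =>
    rw [hid]
    simpa only [hidn] using h ψ
  | star_id =>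
    rw [map_star, hid]
    simp only [map_star, hidn]
    exact tendsto_adjoint_of_isStarNormal hJ hC hR hRn h ψ
  | add f g hf hg =>
    have h1 := (hf ψ).add (hg ψ)
    rw [add_zero] at h1
    refine squeeze_zero (fun n => norm_nonneg _) (fun n => ?_) h1
    refine (le_of_eq ?_).trans (norm_add_le _ _)
    rw [map_add, map_add]
    simp only [add_apply, map_add]
    congr 1
    abel
  | mul f g hf hg =>
    have h1 := ((hg ψ).const_mul ‖f‖).add (hf (Φ g ψ))
    rw [mul_zero, add_zero] at h1
    refine squeeze_zero (fun n => norm_nonneg _) (fun n => ?_) h1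
    refine le_trans ?_ (add_le_add_left ((Φn n f).le_of_opNorm_le (hΦn n f) _) _)
    refine (le_of_eq ?_).trans (norm_add_le _ _)
    rw [map_mul, map_mul]
    simp only [mul_apply_eq_comp, map_sub]
    congr 1
    abel
  | frequently f hf =>
    rw [Metric.tendsto_atTop]
    intro ε hε
    obtain ⟨g, hg, hgf⟩ := (hf.and_eventually
      (Metric.ball_mem_nhds f (by positivity : 0 < ε / (2 * (2 * C * ‖ψ‖ + 1))))).exists
    obtain ⟨N, hN⟩ := Metric.tendsto_atTop.mp (hg ψ) (ε / 2) (by positivity)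
    refine ⟨N, fun n hn => ?_⟩
    have h3 := hN n hn
    rw [dist_zero_right, norm_norm] at h3 ⊢
    have e : Φn n f (J n ψ) - J n (Φ f ψ) = (Φn n (f - g) (J n ψ) - J n (Φ (f - g) ψ))
        + (Φn n g (J n ψ) - J n (Φ g ψ)) := by
      rw [map_sub, map_sub]
      simp only [sub_apply, map_sub]
      abel
    have h4 : ‖Φn n (f - g) (J n ψ)‖ ≤ ‖f - g‖ * (C * ‖ψ‖) :=
      ((Φn n (f - g)).le_of_opNorm_le (hΦn n _) _).trans
        (mul_le_mul_of_nonneg_left ((J n).le_of_opNorm_le (hC n) ψ) (norm_nonneg _))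
    have h5 : ‖J n (Φ (f - g) ψ)‖ ≤ C * (‖f - g‖ * ‖ψ‖) :=
      ((J n).le_of_opNorm_le (hC n) _).trans
        (mul_le_mul_of_nonneg_left ((Φ (f - g)).le_of_opNorm_le (hΦ _) ψ) hC0)
    have h6 : ‖Φn n (f - g) (J n ψ) - J n (Φ (f - g) ψ)‖ ≤ ε / 2 := by
      calc _ ≤ ‖f - g‖ * (C * ‖ψ‖) + C * (‖f - g‖ * ‖ψ‖) :=
            (norm_sub_le _ _).trans (add_le_add h4 h5)
        _ ≤ (2 * C * ‖ψ‖ + 1) * ‖f - g‖ := by nlinarith [norm_nonneg (f - g)]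
        _ = (2 * C * ‖ψ‖ + 1) * dist g f := by rw [dist_comm, dist_eq_norm]
        _ ≤ (2 * C * ‖ψ‖ + 1) * (ε / (2 * (2 * C * ‖ψ‖ + 1))) :=
            mul_le_mul_of_nonneg_left (Metric.mem_ball.mp hgf).le (by positivity)
        _ = ε / 2 := by field_simp
    rw [e]
    exact (norm_add_le _ _).trans_lt (by linarith)

end Strong

end CfcConvergence

section Extension

lemma tendsto_inv_ofReal_sub (z : ℂ) :
    Tendsto (fun t : ℝ => ((t : ℂ) - z)⁻¹) (cocompact ℝ) (𝓝 0) := by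
  refine tendsto_inv₀_cobounded.comp ?_
  rw [← tendsto_norm_atTop_iff_cobounded]
  refine tendsto_atTop_mono (f := fun t : ℝ => ‖t‖ - ‖z‖) (fun t => ?_) ?_
  · have := norm_sub_norm_le (t : ℂ) z
    rwa [Complex.norm_real] at this
  · exact tendsto_atTop_add_const_right _ _ (tendsto_norm_cocompact_atTop)

/-- A continuous function on a closed set of reals with a limit at infinity is the composition of
a continuous function on `ℂ` with `t ↦ (t - z)⁻¹`, for `z` outside the closed set. -/
lemma exists_continuous_comp_inv_sub {S : Set ℝ} (hS : IsClosed S) {z : ℂ}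
    (hz : ∀ t ∈ S, (t : ℂ) ≠ z) {f : ℝ → ℂ} (hf : ContinuousOn f S) {c : ℂ}
    (hc : Tendsto f (cocompact ℝ ⊓ 𝓟 S) (𝓝 c)) :
    ∃ F : ℂ → ℂ, Continuous F ∧ ∀ t ∈ S, F ((t : ℂ) - z)⁻¹ = f t := by
  have hcc : Tendsto (Subtype.val : S → ℝ) (coclosedCompact S) (cocompact ℝ ⊓ 𝓟 S) := by
    rw [coclosedCompact_eq_cocompact]
    exact tendsto_inf.mpr ⟨hS.isClosedEmbedding_subtypeVal.tendsto_cocompact,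
      tendsto_principal.mpr (Eventually.of_forall fun t => t.2)⟩
  have hne : ∀ t : S, ((t : ℝ) : ℂ) - z ≠ 0 := fun t => sub_ne_zero.mpr (hz t t.2)
  let e₀ : C(S, ℂ) := ⟨fun t => (((t : ℝ) : ℂ) - z)⁻¹,
    (by fun_prop : Continuous fun t : S => ((t : ℝ) : ℂ) - z).inv₀ hne⟩
  let e : C(OnePoint S, ℂ) := OnePoint.continuousMapMk e₀ 0
    (((tendsto_inv_ofReal_sub z).mono_left inf_le_left).comp hcc)
  let g : C(OnePoint S, ℂ) := OnePoint.continuousMapMk ⟨fun t => f t, hf.domRestrict⟩ c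
    (hc.comp hcc)
  have he : ∀ t : S, e t = (((t : ℝ) : ℂ) - z)⁻¹ := fun t => rfl
  have he' : e OnePoint.infty = 0 := rfl
  have hinj : Function.Injective e := by
    intro x y
    induction x using OnePoint.rec with
    | infty =>
      induction y using OnePoint.rec with
      | infty => exact fun _ => rfl
      | coe t => exact fun h => absurd h.symm (inv_ne_zero (hne t))
    | coe s =>
      induction y using OnePoint.rec with
      | infty => exact fun h => absurd h (inv_ne_zero (hne s))
      | coe t =>
        intro h
        rw [he, he, inv_inj, sub_left_inj] at h
        rw [Subtype.ext (Complex.ofReal_injective h)]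
  obtain ⟨F, hF⟩ := ContinuousMap.exists_extension
    (e.continuous.isClosedEmbedding hinj) g
  refine ⟨F, F.continuous, fun t ht => ?_⟩
  exact congrArg (fun h : C(OnePoint S, ℂ) => h ((⟨t, ht⟩ : S) : OnePoint S)) hF

end Extension

section Invertible

variable {H K : Type*} [NormedAddCommGroup H] [InnerProductSpace ℂ H] [CompleteSpace H]
  [NormedAddCommGroup K] [InnerProductSpace ℂ K] [CompleteSpace K]

lemma isInvertible_of_norm_sub_lt_one {J : H →L[ℂ] K}
    (h1 : ‖ContinuousLinearMap.adjoint J ∘L J - ContinuousLinearMap.id ℂ H‖ < 1)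
    (h2 : ‖J ∘L ContinuousLinearMap.adjoint J - ContinuousLinearMap.id ℂ K‖ < 1) :
    J.IsInvertible := by
  rw [norm_sub_rev] at h1 h2
  have u1 := isUnit_one_sub_of_norm_lt_one h1
  have u2 := isUnit_one_sub_of_norm_lt_one h2
  obtain ⟨a, ha⟩ := u1.exists_left_inv
  obtain ⟨b, hb⟩ := u2.exists_right_inv
  have ha' : ∀ x, a (ContinuousLinearMap.adjoint J (J x)) = x := fun x => by
    have := DFunLike.congr_fun ha x
    simpa [mul_apply_eq_comp] using this
  have hb' : ∀ x, J (ContinuousLinearMap.adjoint J (b x)) = x := fun x => by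
    have := DFunLike.congr_fun hb x
    simpa [mul_apply_eq_comp] using this
  refine ContinuousLinearMap.IsInvertible.of_inverse (g := ContinuousLinearMap.adjoint J ∘L b)
    (ContinuousLinearMap.ext hb') (ContinuousLinearMap.ext fun x => ?_)
  have h3 := ha' (ContinuousLinearMap.adjoint J (b (J x)))
  rw [hb', ha'] at h3
  exact h3.symm

lemma norm_inverse_sub_adjoint_le {J : H →L[ℂ] K} (hJ : J.IsInvertible) {C : ℝ} (hC : ‖J‖ ≤ C)
    (h2 : ‖J ∘L ContinuousLinearMap.adjoint J - ContinuousLinearMap.id ℂ K‖ ≤ 1 / 2) :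
    ‖J.inverse - ContinuousLinearMap.adjoint J‖
      ≤ 2 * C * ‖J ∘L ContinuousLinearMap.adjoint J - ContinuousLinearMap.id ℂ K‖ := by
  have hJi : ∀ x, J.inverse (J x) = x := fun x => (hJ.inverse_apply_eq).mpr rfl
  have e : J.inverse - ContinuousLinearMap.adjoint J
      = -(J.inverse ∘L (J ∘L ContinuousLinearMap.adjoint J - ContinuousLinearMap.id ℂ K)) := by
    ext x
    simp [hJi]
  have h3 : ‖J.inverse - ContinuousLinearMap.adjoint J‖
      ≤ ‖J.inverse‖ * ‖J ∘L ContinuousLinearMap.adjoint J - ContinuousLinearMap.id ℂ K‖ := by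
    rw [e, norm_neg]
    exact ContinuousLinearMap.opNorm_comp_le _ _
  have h4 : ‖J.inverse‖ ≤ 2 * C := by
    have h5 : ‖J.inverse‖ ≤ ‖J.inverse - ContinuousLinearMap.adjoint J‖ + ‖J‖ := by
      rw [← LinearIsometryEquiv.norm_map ContinuousLinearMap.adjoint J]
      simpa using norm_add_le (J.inverse - ContinuousLinearMap.adjoint J)
        (ContinuousLinearMap.adjoint J)
    nlinarith [norm_nonneg J.inverse]
  exact h3.trans (mul_le_mul_of_nonneg_right h4 (norm_nonneg _))

end Invertible

section Main

variable {H : Type*} [NormedAddCommGroup H] [InnerProductSpace ℂ H]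
  {K : ℕ → Type*} [∀ n, NormedAddCommGroup (K n)] [∀ n, InnerProductSpace ℂ (K n)]
  {J : ∀ n, H →L[ℂ] K n} {A : H →ₗ.[ℂ] H} {An : ∀ n, K n →ₗ.[ℂ] K n} {z : ℂ} {f : ℝ → ℂ}

lemma IsResolventAt.spectrum_subset {R : H →L[ℂ] H} {B : H →ₗ.[ℂ] H} (hR : IsResolventAt B z R)
    {d : ℝ} (hd : 0 < d) (hB : ∀ w ∈ opSpectrum B, d ≤ ‖w - z‖) :
    spectrum ℂ R ⊆ Metric.closedBall 0 d⁻¹ := by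
  intro w hw
  rw [mem_closedBall_zero_iff]
  rcases eq_or_ne w 0 with rfl | hw0
  · simpa using hd.le
  · have := hB _ (hR.mem_opSpectrum_of_mem_spectrum hw hw0)
    rw [add_sub_cancel_left, norm_inv] at this
    exact (le_inv_comm₀ hd (norm_pos_iff.mpr hw0)).mp this

lemma isClosed_realJointSpectrum : IsClosed (realJointSpectrum An A) :=
  isClosed_closure.preimage Complex.continuous_ofReal

lemma opSpectrum_subset_jointSpectrum : opSpectrum A ⊆ jointSpectrum An A :=
  Set.subset_union_left.trans subset_closure

lemma opSpectrum_subset_jointSpectrum' (n : ℕ) : opSpectrum (An n) ⊆ jointSpectrum An A :=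
  (Set.subset_iUnion (fun n => opSpectrum (An n)) n).trans
    (Set.subset_union_right.trans subset_closure)

lemma exists_le_norm_sub (hz : z ∈ (jointSpectrum An A)ᶜ) :
    ∃ d : ℝ, 0 < d ∧ ∀ w ∈ jointSpectrum An A, d ≤ ‖w - z‖ := by
  obtain ⟨d, hd, h⟩ := Metric.isOpen_iff.mp (isClosed_closure (s :=
    opSpectrum A ∪ ⋃ n, opSpectrum (An n))).isOpen_compl z hz
  refine ⟨d, hd, fun w hw => ?_⟩
  by_contra hlt
  exact h (mem_ball_iff_norm.mpr (not_le.mp hlt)) hw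

lemma isResolventAt_of_notMem_jointSpectrum (hz : z ∈ (jointSpectrum An A)ᶜ) :
    IsResolventAt A z (opResolvent A z) ∧ ∀ n, IsResolventAt (An n) z (opResolvent (An n) z) :=
  ⟨isResolventAt_opResolvent
      (not_not.mp fun h => hz (opSpectrum_subset_jointSpectrum h)),
    fun n => isResolventAt_opResolvent
      (not_not.mp fun h => hz (opSpectrum_subset_jointSpectrum' n h))⟩

lemma ne_of_mem_realJointSpectrum (hz : z ∈ (jointSpectrum An A)ᶜ) :
    ∀ t ∈ realJointSpectrum An A, (t : ℂ) ≠ z := by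
  rintro t ht rfl
  exact hz ht

lemma exists_continuous_eq_inv_sub_mul (hz : z ∈ (jointSpectrum An A)ᶜ)
    (hf : BoundedContinuousOn f (realJointSpectrum An A)) :
    ∃ G : ℂ → ℂ, Continuous G ∧
      ∀ t ∈ realJointSpectrum An A, G ((t : ℂ) - z)⁻¹ = ((t : ℂ) - z)⁻¹ * f t := by
  obtain ⟨hfc, M, hM⟩ := hf
  have hne := ne_of_mem_realJointSpectrum hz
  refine exists_continuous_comp_inv_sub (c := 0) isClosed_realJointSpectrum hne
    ((ContinuousOn.inv₀ (by fun_prop) fun t ht => sub_ne_zero.mpr (hne t ht)).mul hfc) ?_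
  refine squeeze_zero_norm' (a := fun t : ℝ => ‖((t : ℂ) - z)⁻¹‖ * M) ?_ ?_
  · filter_upwards [mem_inf_of_right (mem_principal_self _)] with t ht
    rw [norm_mul]
    exact mul_le_mul_of_nonneg_left (hM t ht) (norm_nonneg _)
  · have := ((tendsto_inv_ofReal_sub z).norm.mul_const M).mono_left
      (inf_le_left (b := 𝓟 (realJointSpectrum An A)))
    simpa using this

variable [CompleteSpace H] [∀ n, CompleteSpace (K n)]

lemma functionOf_eq_cfc {B : H →ₗ.[ℂ] H} (hB : IsSelfAdjoint B) {R : H →L[ℂ] H}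
    (hR : IsResolventAt B z R) {M : ℝ} (hM : 0 ≤ M)
    (hf : ∀ t : ℝ, (t : ℂ) ∈ opSpectrum B → ‖f t‖ ≤ M) {F : ℂ → ℂ} (hF : Continuous F)
    (hFf : ∀ t : ℝ, (t : ℂ) ∈ opSpectrum B → F ((t : ℂ) - z)⁻¹ = f t) :
    functionOf B f = cfc F R := by
  have hn := hR.isStarNormal hB
  have h1 := (hR.functionOf_spec hB hM hf (G := fun w => F w * w) (by fun_prop)
    (fun t ht => by rw [hFf t ht, mul_comm])).1
  rw [cfc_mul F (fun w => w) R hF.continuousOn continuous_id.continuousOn, cfc_id' ℂ R] at h1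
  have h2 : (functionOf B f : H → H) = cfc F R :=
    (hR.denseRange hB).equalizer (functionOf B f).continuous (cfc F R).continuous
      (funext fun φ => DFunLike.congr_fun h1 φ)
  exact DFunLike.coe_injective h2

theorem tendsto_adjoint_comp_functionOf (hA : IsSelfAdjoint A) (hAn : ∀ n, IsSelfAdjoint (An n))
    (h : GenNormResolventConv J An A) (hf : BoundedContinuousOn f (realJointSpectrum An A))
    (hlim : EqualLimitsAtInfty f (realJointSpectrum An A)) :
    Tendsto (fun n => ContinuousLinearMap.adjoint (J n) ∘L functionOf (An n) f ∘L J n) atTop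
      (𝓝 (functionOf A f)) := by
  obtain ⟨⟨C, -, hC⟩, h1, h2, z, hz, hconv⟩ := h
  obtain ⟨hfc, M, hM⟩ := hf
  obtain ⟨c, hbot, htop⟩ := hlim
  obtain ⟨d, hd, hdist⟩ := exists_le_norm_sub hz
  obtain ⟨hR, hRn⟩ := isResolventAt_of_notMem_jointSpectrum hz
  have hc : Tendsto f (cocompact ℝ ⊓ 𝓟 (realJointSpectrum An A)) (𝓝 c) := by
    rw [cocompact_eq_atBot_atTop, inf_sup_right]
    exact hbot.sup htop
  obtain ⟨F, hF, hFf⟩ := exists_continuous_comp_inv_sub isClosed_realJointSpectrum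
    (ne_of_mem_realJointSpectrum hz) hfc hc
  have hM0 : 0 ≤ |M| := abs_nonneg M
  have hM' : ∀ t ∈ realJointSpectrum An A, ‖f t‖ ≤ |M| := fun t ht =>
    (hM t ht).trans (le_abs_self M)
  rw [functionOf_eq_cfc hA hR hM0 (fun t ht => hM' t (opSpectrum_subset_jointSpectrum ht)) hF
    (fun t ht => hFf t (opSpectrum_subset_jointSpectrum ht))]
  simp_rw [fun n => functionOf_eq_cfc (hAn n) (hRn n) hM0
    (fun t ht => hM' t (opSpectrum_subset_jointSpectrum' n ht)) hF
    (fun t ht => hFf t (opSpectrum_subset_jointSpectrum' n ht))]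
  exact tendsto_cfc_of_tendsto hC h1 h2 (hR.isStarNormal hA)
    (fun n => (hRn n).isStarNormal (hAn n)) (isCompact_closedBall 0 d⁻¹)
    (hR.spectrum_subset hd fun w hw => hdist w (opSpectrum_subset_jointSpectrum hw))
    (fun n => (hRn n).spectrum_subset hd fun w hw =>
      hdist w (opSpectrum_subset_jointSpectrum' n hw))
    (tendsto_iff_norm_sub_tendsto_zero.mpr hconv) hF

omit [CompleteSpace H] in
lemma exists_norm_functionOf_le (hAn : ∀ n, IsSelfAdjoint (An n))
    (hz : z ∈ (jointSpectrum An A)ᶜ) (hf : BoundedContinuousOn f (realJointSpectrum An A)) :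
    ∃ M : ℝ, ∀ n, ‖functionOf (An n) f‖ ≤ M := by
  obtain ⟨G, hG, hGf⟩ := exists_continuous_eq_inv_sub_mul hz hf
  obtain ⟨-, M, hM⟩ := hf
  refine ⟨|M|, fun n => ?_⟩
  exact (((isResolventAt_of_notMem_jointSpectrum hz).2 n).functionOf_spec (hAn n) (abs_nonneg M)
    (fun t ht => (hM t (opSpectrum_subset_jointSpectrum' n ht)).trans (le_abs_self M)) hG
    (fun t ht => hGf t (opSpectrum_subset_jointSpectrum' n ht))).2

theorem tendsto_inverse_comp_of_tendsto_adjoint_comp {C : ℝ} (hC : ∀ n, ‖J n‖ ≤ C)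
    (hinv : ∀ᶠ n in atTop, (J n).IsInvertible)
    (h2 : Tendsto (fun n => ‖J n ∘L ContinuousLinearMap.adjoint (J n)
      - ContinuousLinearMap.id ℂ (K n)‖) atTop (𝓝 0))
    {T : H →L[ℂ] H} {Tn : ∀ n, K n →L[ℂ] K n} {M : ℝ} (hM : ∀ n, ‖Tn n‖ ≤ M)
    (h : Tendsto (fun n => ContinuousLinearMap.adjoint (J n) ∘L Tn n ∘L J n) atTop (𝓝 T)) :
    Tendsto (fun n => (J n).inverse ∘L Tn n ∘L J n) atTop (𝓝 T) := by
  have hC0 : 0 ≤ C := (norm_nonneg _).trans (hC 0)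
  have hM0 : 0 ≤ M := (norm_nonneg _).trans (hM 0)
  have h3 : Tendsto (fun n => ((J n).inverse - ContinuousLinearMap.adjoint (J n)) ∘L Tn n ∘L J n)
      atTop (𝓝 0) := by
    have h4 := (h2.const_mul (2 * C)).mul_const (M * C)
    rw [mul_zero, zero_mul] at h4
    refine squeeze_zero_norm' ?_ h4
    filter_upwards [hinv, h2.eventually_le_const (by norm_num : (0 : ℝ) < 1 / 2)] with n hn hn2
    refine (ContinuousLinearMap.opNorm_comp_le _ _).trans (mul_le_mul
      (norm_inverse_sub_adjoint_le hn (hC n) hn2) ?_ (norm_nonneg _) (by positivity))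
    exact (ContinuousLinearMap.opNorm_comp_le _ _).trans
      (mul_le_mul (hM n) (hC n) (norm_nonneg _) hM0)
  have h5 := h3.add h
  rw [zero_add] at h5
  refine h5.congr fun n => ?_
  rw [ContinuousLinearMap.sub_comp, sub_add_cancel]

theorem tendsto_adjoint_functionOf_apply (hA : IsSelfAdjoint A) (hAn : ∀ n, IsSelfAdjoint (An n))
    (h : GenStrongResolventConv J An A) (hf : BoundedContinuousOn f (realJointSpectrum An A))
    (ψ : H) :
    Tendsto (fun n => ContinuousLinearMap.adjoint (J n) (functionOf (An n) f (J n ψ))) atTop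
      (𝓝 (functionOf A f ψ)) := by
  obtain ⟨⟨C, -, hC⟩, hJ, z, hz, hconv, hreal⟩ := h
  obtain ⟨G, hG, hGf⟩ := exists_continuous_eq_inv_sub_mul hz hf
  obtain ⟨-, M, hM⟩ := hf
  obtain ⟨d, hd, hdist⟩ := exists_le_norm_sub hz
  obtain ⟨hR, hRn⟩ := isResolventAt_of_notMem_jointSpectrum hz
  have hC0 : 0 ≤ C := (norm_nonneg _).trans (hC 0)
  have hM0 : 0 ≤ |M| := abs_nonneg M
  have hM' : ∀ t ∈ realJointSpectrum An A, ‖f t‖ ≤ |M| := fun t ht =>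
    (hM t ht).trans (le_abs_self M)
  obtain ⟨hT, hTM⟩ := hR.functionOf_spec hA hM0
    (fun t ht => hM' t (opSpectrum_subset_jointSpectrum ht)) hG
    (fun t ht => hGf t (opSpectrum_subset_jointSpectrum ht))
  have hTn := fun n => (hRn n).functionOf_spec (hAn n) hM0
    (fun t ht => hM' t (opSpectrum_subset_jointSpectrum' n ht)) hG
    (fun t ht => hGf t (opSpectrum_subset_jointSpectrum' n ht))
  have hRconv : ∀ ψ, Tendsto (fun n => ‖opResolvent (An n) z (J n ψ) - J n (opResolvent A z ψ)‖)
      atTop (𝓝 0) := by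
    by_cases him : z.im = 0
    · exact hreal him
    · exact tendsto_resolvent_of_im_ne_zero hJ him (hR.im_inner hA)
        (fun n => (hRn n).im_inner (hAn n)) hconv
  have hGconv := tendsto_cfc_apply_of_tendsto hJ hC (hR.isStarNormal hA)
    (fun n => (hRn n).isStarNormal (hAn n)) (isCompact_closedBall 0 d⁻¹)
    (hR.spectrum_subset hd fun w hw => hdist w (opSpectrum_subset_jointSpectrum hw))
    (fun n => (hRn n).spectrum_subset hd fun w hw =>
      hdist w (opSpectrum_subset_jointSpectrum' n hw)) hRconv hG
  have key := tendsto_zero_of_denseRange (T := fun n => ContinuousLinearMap.adjoint (J n) ∘L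
    functionOf (An n) f ∘L J n - functionOf A f) (C := C * C * |M| + |M|)
    (fun n => (norm_sub_le _ _).trans (add_le_add
      ((norm_adjoint_comp_comp_le hC n _).trans
        (mul_le_mul_of_nonneg_left (hTn n).2 (by positivity))) hTM))
    (hR.denseRange hA) (fun φ => ?_) ψ
  · rw [← tendsto_sub_nhds_zero_iff]
    exact key
  · have h1 := (((hRconv φ).const_mul (C * |M|)).add ((hGconv φ).const_mul C)).add
      (hJ (cfc G (opResolvent A z) φ))
    simp only [mul_zero, add_zero] at h1
    refine squeeze_zero_norm (fun n => ?_) h1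
    have e1 : functionOf A f (opResolvent A z φ) = cfc G (opResolvent A z) φ :=
      DFunLike.congr_fun hT φ
    have e2 : functionOf (An n) f (opResolvent (An n) z (J n φ))
        = cfc G (opResolvent (An n) z) (J n φ) := DFunLike.congr_fun (hTn n).1 (J n φ)
    have e3 : (ContinuousLinearMap.adjoint (J n) ∘L functionOf (An n) f ∘L J n
          - functionOf A f) (opResolvent A z φ)
        = -ContinuousLinearMap.adjoint (J n) (functionOf (An n) f
            (opResolvent (An n) z (J n φ) - J n (opResolvent A z φ)))
          + ContinuousLinearMap.adjoint (J n) (cfc G (opResolvent (An n) z) (J n φ)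
            - J n (cfc G (opResolvent A z) φ))
          + (ContinuousLinearMap.adjoint (J n) (J n (cfc G (opResolvent A z) φ))
            - cfc G (opResolvent A z) φ) := by
      simp only [sub_apply, ContinuousLinearMap.comp_apply, map_sub, e1, e2]
      abel
    have hJ' : ‖ContinuousLinearMap.adjoint (J n)‖ ≤ C := by
      rw [LinearIsometryEquiv.norm_map]
      exact hC n
    rw [e3]
    refine (norm_add₃_le).trans (add_le_add_left (add_le_add ?_ ?_) _)
    · rw [norm_neg, mul_assoc]
      exact (ContinuousLinearMap.le_of_opNorm_le _ hJ' _).trans (mul_le_mul_of_nonneg_left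
        (ContinuousLinearMap.le_of_opNorm_le _ (hTn n).2 _) hC0)
    · exact ContinuousLinearMap.le_of_opNorm_le _ hJ' _

end Main

end ResolventConvergence

theorem mainTheorem1
    {H : Type*} [NormedAddCommGroup H] [InnerProductSpace ℂ H] [CompleteSpace H]
    {K : ℕ → Type*} [∀ n, NormedAddCommGroup (K n)] [∀ n, InnerProductSpace ℂ (K n)]
    [∀ n, CompleteSpace (K n)]
    (J : ∀ n, H →L[ℂ] K n)
    (A : H →ₗ.[ℂ] H) (An : ∀ n, K n →ₗ.[ℂ] K n)
    (hA : IsSelfAdjoint A) (hAn : ∀ n, IsSelfAdjoint (An n)) :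
    (ResolventConvergence.GenNormResolventConv J An A →
      (∀ᶠ n in atTop, (J n).IsInvertible) ∧
      ∀ f : ℝ → ℂ,
        ResolventConvergence.BoundedContinuousOn f
          (ResolventConvergence.realJointSpectrum An A) →
        ResolventConvergence.EqualLimitsAtInfty f
          (ResolventConvergence.realJointSpectrum An A) →
        Tendsto (fun n => ContinuousLinearMap.adjoint (J n) ∘L ResolventConvergence.functionOf (An n) f ∘L J n) atTop
          (𝓝 (ResolventConvergence.functionOf A f)) ∧
        Tendsto (fun n => (J n).inverse ∘L ResolventConvergence.functionOf (An n) f ∘L J n) atTop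
          (𝓝 (ResolventConvergence.functionOf A f))) ∧
    (ResolventConvergence.GenStrongResolventConv J An A →
      ∀ f : ℝ → ℂ,
        ResolventConvergence.BoundedContinuousOn f
          (ResolventConvergence.realJointSpectrum An A) →
        ∀ ψ : H,
          Tendsto (fun n => ContinuousLinearMap.adjoint (J n) (ResolventConvergence.functionOf (An n) f (J n ψ))) atTop
            (𝓝 (ResolventConvergence.functionOf A f ψ))) := by
  refine ⟨fun h => ?_, fun h f hf ψ =>
    ResolventConvergence.tendsto_adjoint_functionOf_apply hA hAn h hf ψ⟩
  obtain ⟨⟨C, -, hC⟩, h1, h2, z, hz, -⟩ := id h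
  have hinv : ∀ᶠ n in atTop, (J n).IsInvertible := by
    filter_upwards [h1.eventually_lt_const one_pos, h2.eventually_lt_const one_pos] with n hn1 hn2
    exact ResolventConvergence.isInvertible_of_norm_sub_lt_one hn1 hn2
  refine ⟨hinv, fun f hf hlim => ?_⟩
  have hadj := ResolventConvergence.tendsto_adjoint_comp_functionOf hA hAn h hf hlim
  obtain ⟨M, hM⟩ := ResolventConvergence.exists_norm_functionOf_le hAn hz hf
  exact ⟨hadj, ResolventConvergence.tendsto_inverse_comp_of_tendsto_adjoint_comp
    hC hinv h2 hM hadj⟩
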